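/- Let $m>0$ and $0<\epsilon<\frac1{2m}$. For $k\in\mathbb R$ consider on $L^2(\mathbb R_+;\mathbb C^2)$ the edge Hamiltonian $$H^\sharp(k)=\begin{pmatrix} m-\epsilon k^2+\epsilon\partial_y^2 & -k+\partial_y\\ -k-\partial_y & -m+\epsilon k^2-\epsilon\partial_y^2\end{pmatrix}.$$ Let $B_0,B_1,B_2\in \mathrm M_2(\mathbb C)$, $A_0=[B_0\,|\,B_2]$, $A_1=[B_1\,|\,0]$ and $A(k)=A_0+\mathrm i kA_1\in \mathrm M_{2,4}(\mathbb C)$. The operator $H^\sharp(k)$ with boundary condition $A(k)$ has the domain $\{\psi\in H^2(\mathbb R_+)\oplus H^2(\mathbb R_+) : A(k)\Psi=0\}$, where $\Psi=(\psi_1(0),\psi_2(0),\psi_1'(0),\psi_2'(0))^{T}$. Two matrices $A,\widetilde A\in \mathrm M_{2,4}(\mathbb C)$ are called equivalent if $\widetilde A=GA$ for some $G\in \mathrm{GL}_2(\mathbb C)$. Consider the following seven classes of pairs $(A_0,A_1)$, in which $\alpha,\beta,\alpha_i,\beta_i$ are arbitrary real and all other parameters arbitrary complex numbers, subject to the stated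 constraints: - $\mathfrak A_{1,2}$: $A_0=\begin{pmatrix}1&0&0&0\\0&1&0&0\end{pmatrix}$, $A_1=\begin{pmatrix}b_{11}&b_{12}&0&0\\b_{21}&b_{22}&0&0\end{pmatrix}$; - $\mathfrak A_{1,4}$: $A_0=\begin{pmatrix}1&0&0&0\\0&\alpha&0&1\end{pmatrix}$, $A_1=\begin{pmatrix}b_{11}&0&0&0\\b_{21}&\mathrm i\beta&0&0\end{pmatrix}$; - $\mathfrak A_{2,3}$: $A_0=\begin{pmatrix}0&1&0&0\\\alpha&0&1&0\end{pmatrix}$, $A_1=\begin{pmatrix}0&b_{12}&0&0\\\mathrm i\beta&b_{22}&0&0\end{pmatrix}$; - $\mathfrak A_{2,4}$: $A_0=\begin{pmatrix}a_{11}&1&0&0\\a_{21}&0&(a_{11}^*)^{-1}&1\end{pmatrix}$, $A_1=\begin{pmatrix}b_{11}&b_{11}a_{11}^{-1}&0&0\\b_{21}&b_{22}&0&0\end{pmatrix}$ with $a_{11}\neq0$, $a_{21}=\alpha a_{11}+\epsilon^{-1}$, $b_{22}-b_{21}a_{11}^{-1}=\mathrm i\beta$; - $\mathfrak A_{3,4}$: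 $A_0=\begin{pmatrix}\alpha_1&a_{12}&1&0\\\epsilon^{-1}-a_{12}^*&\alpha_2&0&1\end{pmatrix}$, $A_1=\begin{pmatrix}\mathrm i\beta_1&b_{12}&0&0\\b_{12}^*&\mathrm i\beta_2&0&0\end{pmatrix}$; - $\mathfrak B$: $A_0=\begin{pmatrix}a_1&a_2&\mathrm i\alpha&-\mathrm i\mu^*\alpha\\\mu a_1&\mu a_2&\mathrm i\mu\alpha&-\mathrm i|\mu|^2\alpha\end{pmatrix}$, $A_1=\begin{pmatrix}1&0&0&0\\0&1&0&0\end{pmatrix}$ with $\alpha\big(\alpha\,\mathrm{Im}\,\mu+\epsilon\,\mathrm{Re}(a_1+a_2\mu)\big)=0$; - $\mathfrak C$: $A_0=\begin{pmatrix}a_1&a_2&0&a_4\\\mu a_1&\mu a_2&0&\mu a_4\end{pmatrix}$, $A_1=\begin{pmatrix}1&0&0&0\\0&0&0&0\end{pmatrix}$ with $(a_2,a_4)\neq(0,0)$, $\mu\neq0$, $\mathrm{Im}(a_2a_4^*)=0$. Then: 1. $H^\sharp(k)$ with boundary condition $A(k)$ is self-adjoint for almost every $k\in\mathbb R$ if and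 only if there is a pair $(A_0',A_1')$ in one of the seven classes such that, for almost every $k\in\mathbb R$, $A(k)$ has rank $2$ and is equivalent to $A_0'+\mathrm i kA_1'$ (the matrix $G\in\mathrm{GL}_2(\mathbb C)$ may depend on $k$, the pair $(A_0',A_1')$ does not). 2. For every fixed $k\in\mathbb R$, $H^\sharp(k)$ with boundary condition $A(k)$ is self-adjoint if and only if $A(k)$ has rank $2$ and is equivalent to $A_0'+\mathrm ikA_1'$ for some pair $(A_0',A_1')$ in one of the seven classes. 3. If $A_0$ has rank $2$, then $H^\sharp(k)$ with boundary condition $A(k)$ is self-adjoint for almost every $k\in\mathbb R$ if and only if there are a single $G\in\mathrm{GL}_2(\mathbb C)$, independent of $k$, and a pair $(A_0',A_1')$ in one of the five classes $\mathfrak A_{i,j}$ with $A_0'=GA_0$ and $A_1'=GA_1$. -/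

import Mathlib

namespace EdgeDirac

open MeasureTheory Set
open scoped ContDiff

/-- Lebesgue measure on the half-line `(0, ∞)`. -/
noncomputable abbrev halfLine : Measure ℝ := volume.restrict (Ioi (0 : ℝ))

/-- `L²(ℝ₊; ℂ)`. -/
abbrev L2 : Type := Lp ℂ 2 halfLine

/-- `L²(ℝ₊; ℂ²) = L²(ℝ₊) ⊕ L²(ℝ₊)` with its Hilbert space structure. -/
abbrev Spinor : Type := WithLp 2 (L2 × L2)

/-! ### Sobolev space and boundary values on the half-line -/

/-- `φ` is a (real) test function on the open half-line. -/
structure IsTest (φ : ℝ → ℝ) : Prop where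
  smooth : ContDiff ℝ ∞ φ
  compact : HasCompactSupport φ
  support : tsupport φ ⊆ Ioi (0 : ℝ)

/-- `g` is the weak derivative of `f` on `(0, ∞)`. -/
def IsWeakDeriv (f g : L2) : Prop :=
  ∀ φ : ℝ → ℝ, IsTest φ →
    ∫ y, deriv φ y • f y ∂halfLine = -∫ y, φ y • g y ∂halfLine

open Classical in
/-- The weak derivative in `L²` (it is unique); `0` if there is none. -/
noncomputable def weakDeriv (f : L2) : L2 :=
  if h : ∃ g, IsWeakDeriv f g then h.choose else 0

theorem integrable_test_smul {φ : ℝ → ℝ} (hc : Continuous φ) (hs : HasCompactSupport φ) (f : L2) :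
    Integrable (fun y => φ y • f y) halfLine := by
  have h1 : MemLp φ 2 halfLine := hc.memLp_of_hasCompactSupport hs
  have h2 : MemLp (f : ℝ → ℂ) 2 halfLine := Lp.memLp f
  exact memLp_one_iff_integrable.1 (MemLp.smul (p := 2) (q := 2) h2 h1)

theorem IsTest.integrable {φ : ℝ → ℝ} (h : IsTest φ) (f : L2) :
    Integrable (fun y => φ y • f y) halfLine :=
  integrable_test_smul h.smooth.continuous h.compact f

theorem IsTest.integrable_deriv {φ : ℝ → ℝ} (h : IsTest φ) (f : L2) :
    Integrable (fun y => deriv φ y • f y) halfLine :=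
  integrable_test_smul (h.smooth.continuous_deriv (by simp)) h.compact.deriv f

theorem integral_smul_add {φ : ℝ → ℝ} (f g : L2)
    (hf : Integrable (fun y => φ y • f y) halfLine)
    (hg : Integrable (fun y => φ y • g y) halfLine) :
    ∫ y, φ y • (f + g : L2) y ∂halfLine
      = ∫ y, φ y • f y ∂halfLine + ∫ y, φ y • g y ∂halfLine := by
  rw [← integral_add hf hg]
  refine integral_congr_ae ?_
  filter_upwards [Lp.coeFn_add f g] with y hy
  rw [hy, Pi.add_apply, smul_add]

theorem integral_smul_smul {φ : ℝ → ℝ} (c : ℂ) (f : L2) :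
    ∫ y, φ y • (c • f : L2) y ∂halfLine = c * ∫ y, φ y • f y ∂halfLine := by
  rw [← integral_const_mul]
  refine integral_congr_ae ?_
  filter_upwards [Lp.coeFn_smul c f] with y hy
  rw [hy, Pi.smul_apply, smul_comm, smul_eq_mul]

theorem IsWeakDeriv.add {f f' g g' : L2} (hf : IsWeakDeriv f f') (hg : IsWeakDeriv g g') :
    IsWeakDeriv (f + g) (f' + g') := by
  intro φ hφ
  rw [integral_smul_add f g (hφ.integrable_deriv f) (hφ.integrable_deriv g),
    integral_smul_add f' g' (hφ.integrable f') (hφ.integrable g'), hf φ hφ, hg φ hφ]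
  ring

theorem IsWeakDeriv.smul {f f' : L2} (c : ℂ) (hf : IsWeakDeriv f f') :
    IsWeakDeriv (c • f) (c • f') := by
  intro φ hφ
  rw [integral_smul_smul, integral_smul_smul, hf φ hφ]
  ring

theorem IsWeakDeriv.zero : IsWeakDeriv 0 0 := by
  intro φ _
  have h := integral_smul_smul (φ := φ) 0 (0 : L2)
  have h' := integral_smul_smul (φ := deriv φ) 0 (0 : L2)
  rw [zero_smul, zero_mul] at h h'
  rw [h, h', neg_zero]

theorem IsWeakDeriv.unique {f g₁ g₂ : L2} (h₁ : IsWeakDeriv f g₁) (h₂ : IsWeakDeriv f g₂) :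
    g₁ = g₂ := by
  have hloc : LocallyIntegrableOn (fun y => g₁ y - g₂ y) (Ioi (0 : ℝ)) volume := by
    rw [locallyIntegrableOn_iff isOpen_Ioi.isLocallyClosed]
    intro K hK hKc
    have h : MemLp (fun y => g₁ y - g₂ y) 2 (volume.restrict K) :=
      ((Lp.memLp g₁).sub (Lp.memLp g₂)).mono_measure (Measure.restrict_mono hK le_rfl)
    have : IsFiniteMeasure (volume.restrict K) := ⟨by simpa using hKc.measure_lt_top⟩
    exact h.integrable (by norm_num)
  have key := isOpen_Ioi.ae_eq_zero_of_integral_contDiff_smul_eq_zero hloc (by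
    intro φ hφ hc hs
    have ht : IsTest φ := ⟨hφ, hc, hs⟩
    have e : ∫ y, φ y • (g₁ y - g₂ y) ∂halfLine = 0 := by
      simp_rw [smul_sub]
      rw [integral_sub (ht.integrable g₁) (ht.integrable g₂)]
      have a := h₁ φ ht
      have b := h₂ φ ht
      rw [a] at b
      rw [neg_injective b, sub_self]
    rw [← e]
    refine (setIntegral_eq_integral_of_forall_compl_eq_zero ?_).symm
    intro y hy
    have : φ y = 0 := image_eq_zero_of_notMem_tsupport fun h => hy (hs h)
    rw [this, zero_smul])
  refine Lp.ext ?_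
  refine (ae_restrict_iff' measurableSet_Ioi).2 ?_
  filter_upwards [key] with y hy hy0
  exact sub_eq_zero.1 (hy hy0)

theorem weakDeriv_eq {f g : L2} (h : IsWeakDeriv f g) : weakDeriv f = g := by
  have hex : ∃ g, IsWeakDeriv f g := ⟨g, h⟩
  rw [weakDeriv, dif_pos hex]
  exact hex.choose_spec.unique h

/-- The Sobolev space `H²(ℝ₊)`. -/
noncomputable def H2 : Submodule ℂ L2 where
  carrier := {f | ∃ f' f'', IsWeakDeriv f f' ∧ IsWeakDeriv f' f''}
  zero_mem' := ⟨0, 0, IsWeakDeriv.zero, IsWeakDeriv.zero⟩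
  add_mem' := by
    rintro f g ⟨f', f'', h1, h2⟩ ⟨g', g'', h3, h4⟩
    exact ⟨f' + g', f'' + g'', h1.add h3, h2.add h4⟩
  smul_mem' := by
    rintro c f ⟨f', f'', h1, h2⟩
    exact ⟨c • f', c • f'', h1.smul c, h2.smul c⟩

theorem weakDeriv_add {f g : L2} (hf : f ∈ H2) (hg : g ∈ H2) :
    weakDeriv (f + g) = weakDeriv f + weakDeriv g := by
  obtain ⟨f', f'', h1, h2⟩ := hf
  obtain ⟨g', g'', h3, h4⟩ := hg
  rw [weakDeriv_eq h1, weakDeriv_eq h3, weakDeriv_eq (h1.add h3)]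

theorem weakDeriv_smul {f : L2} (c : ℂ) (hf : f ∈ H2) :
    weakDeriv (c • f) = c • weakDeriv f := by
  obtain ⟨f', f'', h1, h2⟩ := hf
  rw [weakDeriv_eq h1, weakDeriv_eq (h1.smul c)]

theorem weakDeriv2_add {f g : L2} (hf : f ∈ H2) (hg : g ∈ H2) :
    weakDeriv (weakDeriv (f + g)) = weakDeriv (weakDeriv f) + weakDeriv (weakDeriv g) := by
  obtain ⟨f', f'', h1, h2⟩ := hf
  obtain ⟨g', g'', h3, h4⟩ := hg
  rw [weakDeriv_eq h1, weakDeriv_eq h3, weakDeriv_eq (h1.add h3), weakDeriv_eq h2,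
    weakDeriv_eq h4, weakDeriv_eq (h2.add h4)]

theorem weakDeriv2_smul {f : L2} (c : ℂ) (hf : f ∈ H2) :
    weakDeriv (weakDeriv (c • f)) = c • weakDeriv (weakDeriv f) := by
  obtain ⟨f', f'', h1, h2⟩ := hf
  rw [weakDeriv_eq h1, weakDeriv_eq (h1.smul c), weakDeriv_eq h2, weakDeriv_eq (h2.smul c)]

/-- `f` has boundary value `a` at `y = 0`: its representative that is continuous on `[0, ∞)`
takes the value `a` at `0`. -/
def HasBoundaryValue (f : L2) (a : ℂ) : Prop :=
  ∃ u : ℝ → ℂ, ContinuousOn u (Ici 0) ∧ f =ᵐ[halfLine] u ∧ u 0 = a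

theorem HasBoundaryValue.zero : HasBoundaryValue 0 0 :=
  ⟨0, continuousOn_const, Lp.coeFn_zero _ _ _, rfl⟩

theorem HasBoundaryValue.add {f g : L2} {a b : ℂ} (hf : HasBoundaryValue f a)
    (hg : HasBoundaryValue g b) : HasBoundaryValue (f + g) (a + b) := by
  obtain ⟨u, hu, hfu, hu0⟩ := hf
  obtain ⟨v, hv, hgv, hv0⟩ := hg
  refine ⟨u + v, hu.add hv, (Lp.coeFn_add f g).trans (hfu.add hgv), ?_⟩
  rw [Pi.add_apply, hu0, hv0]

theorem HasBoundaryValue.smul {f : L2} {a : ℂ} (c : ℂ) (hf : HasBoundaryValue f a) :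
    HasBoundaryValue (c • f) (c * a) := by
  obtain ⟨u, hu, hfu, hu0⟩ := hf
  refine ⟨c • u, hu.const_smul c, (Lp.coeFn_smul c f).trans (hfu.const_smul c), ?_⟩
  rw [Pi.smul_apply, hu0, smul_eq_mul]

/-- `Ψ = (ψ₁(0), ψ₂(0), ψ₁'(0), ψ₂'(0))`. -/
structure HasBoundaryVector (ψ : Spinor) (Ψ : Fin 4 → ℂ) : Prop where
  val₁ : HasBoundaryValue ψ.fst (Ψ 0)
  val₂ : HasBoundaryValue ψ.snd (Ψ 1)
  der₁ : HasBoundaryValue (weakDeriv ψ.fst) (Ψ 2)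
  der₂ : HasBoundaryValue (weakDeriv ψ.snd) (Ψ 3)

/-! ### The edge Hamiltonian -/

/-- `{ψ ∈ H² ⊕ H² : A Ψ = 0 at y = 0}`. -/
noncomputable def edgeDomain (A : Matrix (Fin 2) (Fin 4) ℂ) : Submodule ℂ Spinor where
  carrier := {ψ | ψ.fst ∈ H2 ∧ ψ.snd ∈ H2 ∧ ∃ Ψ, HasBoundaryVector ψ Ψ ∧ A.mulVec Ψ = 0}
  zero_mem' := by
    have h0 : weakDeriv 0 = 0 := weakDeriv_eq IsWeakDeriv.zero
    refine ⟨H2.zero_mem, H2.zero_mem, 0, ⟨HasBoundaryValue.zero, HasBoundaryValue.zero, ?_, ?_⟩,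
      Matrix.mulVec_zero A⟩
    · rw [WithLp.zero_fst, h0]; exact HasBoundaryValue.zero
    · rw [WithLp.zero_snd, h0]; exact HasBoundaryValue.zero
  add_mem' := by
    rintro ψ χ ⟨h1, h2, Ψ, hΨ, hA⟩ ⟨h3, h4, Χ, hΧ, hA'⟩
    refine ⟨H2.add_mem h1 h3, H2.add_mem h2 h4, Ψ + Χ,
      ⟨hΨ.val₁.add hΧ.val₁, hΨ.val₂.add hΧ.val₂, ?_, ?_⟩, ?_⟩
    · rw [WithLp.add_fst, weakDeriv_add h1 h3]; exact hΨ.der₁.add hΧ.der₁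
    · rw [WithLp.add_snd, weakDeriv_add h2 h4]; exact hΨ.der₂.add hΧ.der₂
    · rw [Matrix.mulVec_add, hA, hA', add_zero]
  smul_mem' := by
    rintro c ψ ⟨h1, h2, Ψ, hΨ, hA⟩
    refine ⟨H2.smul_mem c h1, H2.smul_mem c h2, c • Ψ,
      ⟨hΨ.val₁.smul c, hΨ.val₂.smul c, ?_, ?_⟩, ?_⟩
    · rw [WithLp.smul_fst, weakDeriv_smul c h1]; exact hΨ.der₁.smul c
    · rw [WithLp.smul_snd, weakDeriv_smul c h2]; exact hΨ.der₂.smul c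
    · rw [Matrix.mulVec_smul, hA, smul_zero]

/-- First component of `H♯(k) ψ`: `(m - ε k² + ε ∂²) ψ₁ + (-k + ∂) ψ₂`. -/
noncomputable def edgeFst (m ε k : ℝ) (ψ : Spinor) : L2 :=
  ((m - ε * k ^ 2 : ℝ) : ℂ) • ψ.fst + (ε : ℂ) • weakDeriv (weakDeriv ψ.fst)
    + (-(k : ℂ) • ψ.snd + weakDeriv ψ.snd)

/-- Second component of `H♯(k) ψ`: `(-k - ∂) ψ₁ + (-m + ε k² - ε ∂²) ψ₂`. -/
noncomputable def edgeSnd (m ε k : ℝ) (ψ : Spinor) : L2 :=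
  (-(k : ℂ) • ψ.fst - weakDeriv ψ.fst)
    + (((-m + ε * k ^ 2 : ℝ) : ℂ) • ψ.snd - (ε : ℂ) • weakDeriv (weakDeriv ψ.snd))

/-- The edge Hamiltonian `H♯(k)` on `L²(ℝ₊; ℂ²)` with boundary condition `A Ψ = 0` at `y = 0`,
as an unbounded operator. -/
noncomputable def edgeHamiltonian (m ε k : ℝ) (A : Matrix (Fin 2) (Fin 4) ℂ) :
    Spinor →ₗ.[ℂ] Spinor where
  domain := edgeDomain A
  toFun :=
    { toFun := fun ψ => WithLp.toLp 2 (edgeFst m ε k ψ, edgeSnd m ε k ψ)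
      map_add' := by
        rintro ⟨ψ, h1, h2, h⟩ ⟨χ, h3, h4, h'⟩
        rw [← WithLp.toLp_add, Prod.mk_add_mk]
        congr 2
        · simp only [edgeFst, Submodule.coe_add, WithLp.add_fst,
            WithLp.add_snd, weakDeriv2_add h1 h3, weakDeriv_add h2 h4, smul_add]
          abel
        · simp only [edgeSnd, Submodule.coe_add, WithLp.add_fst,
            WithLp.add_snd, weakDeriv2_add h2 h4, weakDeriv_add h1 h3, smul_add]
          abel
      map_smul' := by
        rintro c ⟨ψ, h1, h2, h⟩
        rw [RingHom.id_apply, ← WithLp.toLp_smul, Prod.smul_mk]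
        congr 2
        · simp only [edgeFst, Submodule.coe_smul, WithLp.smul_fst, WithLp.smul_snd,
            weakDeriv2_smul c h1, weakDeriv_smul c h2, smul_add, smul_comm c]
        · simp only [edgeSnd, Submodule.coe_smul, WithLp.smul_fst, WithLp.smul_snd,
            weakDeriv2_smul c h2, weakDeriv_smul c h1, smul_add, smul_sub, smul_comm c] }

/-! ### Local boundary conditions -/

/-- The block matrix `[B | C]`. -/
def blocks (B C : Matrix (Fin 2) (Fin 2) ℂ) : Matrix (Fin 2) (Fin 4) ℂ :=
  !![B 0 0, B 0 1, C 0 0, C 0 1;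
     B 1 0, B 1 1, C 1 0, C 1 1]

/-- `A(k) = A₀ + i k A₁`. -/
noncomputable def pencil (A₀ A₁ : Matrix (Fin 2) (Fin 4) ℂ) (k : ℝ) : Matrix (Fin 2) (Fin 4) ℂ :=
  A₀ + (Complex.I * (k : ℂ)) • A₁

/-- Equivalence of boundary conditions: equality up to a left factor in `GL₂(ℂ)`. -/
def Equivalent (A A' : Matrix (Fin 2) (Fin 4) ℂ) : Prop :=
  ∃ G : GL (Fin 2) ℂ, A' = (G : Matrix (Fin 2) (Fin 2) ℂ) * A

/-- Names of the seven classes of boundary conditions. -/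
inductive BCClass
  | A12 | A14 | A23 | A24 | A34 | B | C

open Complex ComplexConjugate in
/-- The pair `(A₀, A₁)` belongs to the given class. -/
def InClass (ε : ℝ) : BCClass → Matrix (Fin 2) (Fin 4) ℂ → Matrix (Fin 2) (Fin 4) ℂ → Prop
  | .A12, A₀, A₁ => ∃ b₁₁ b₁₂ b₂₁ b₂₂ : ℂ,
      A₀ = !![1, 0, 0, 0; 0, 1, 0, 0] ∧
      A₁ = !![b₁₁, b₁₂, 0, 0; b₂₁, b₂₂, 0, 0]
  | .A14, A₀, A₁ => ∃ (α β : ℝ) (b₁₁ b₂₁ : ℂ),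
      A₀ = !![1, 0, 0, 0; 0, (α : ℂ), 0, 1] ∧
      A₁ = !![b₁₁, 0, 0, 0; b₂₁, I * β, 0, 0]
  | .A23, A₀, A₁ => ∃ (α β : ℝ) (b₁₂ b₂₂ : ℂ),
      A₀ = !![0, 1, 0, 0; (α : ℂ), 0, 1, 0] ∧
      A₁ = !![0, b₁₂, 0, 0; I * β, b₂₂, 0, 0]
  | .A24, A₀, A₁ => ∃ (α β : ℝ) (a₁₁ a₂₁ b₁₁ b₂₁ b₂₂ : ℂ),
      a₁₁ ≠ 0 ∧ a₂₁ = α * a₁₁ + (ε : ℂ)⁻¹ ∧ b₂₂ - b₂₁ * a₁₁⁻¹ = I * β ∧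
      A₀ = !![a₁₁, 1, 0, 0; a₂₁, 0, (conj a₁₁)⁻¹, 1] ∧
      A₁ = !![b₁₁, b₁₁ * a₁₁⁻¹, 0, 0; b₂₁, b₂₂, 0, 0]
  | .A34, A₀, A₁ => ∃ (α₁ α₂ β₁ β₂ : ℝ) (a₁₂ b₁₂ : ℂ),
      A₀ = !![(α₁ : ℂ), a₁₂, 1, 0; (ε : ℂ)⁻¹ - conj a₁₂, (α₂ : ℂ), 0, 1] ∧
      A₁ = !![I * β₁, b₁₂, 0, 0; conj b₁₂, I * β₂, 0, 0]
  | .B, A₀, A₁ => ∃ (α : ℝ) (a₁ a₂ μ : ℂ),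
      α * (α * μ.im + ε * (a₁ + a₂ * μ).re) = 0 ∧
      A₀ = !![a₁, a₂, I * α, -(I * conj μ * α);
              μ * a₁, μ * a₂, I * μ * α, -(I * ((‖μ‖ ^ 2 : ℝ) : ℂ) * α)] ∧
      A₁ = !![1, 0, 0, 0; 0, 1, 0, 0]
  | .C, A₀, A₁ => ∃ a₁ a₂ a₄ μ : ℂ,
      (a₂, a₄) ≠ (0, 0) ∧ μ ≠ 0 ∧ (a₂ * conj a₄).im = 0 ∧
      A₀ = !![a₁, a₂, 0, a₄; μ * a₁, μ * a₂, 0, μ * a₄] ∧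
      A₁ = !![1, 0, 0, 0; 0, 0, 0, 0]

end EdgeDirac

namespace EdgeDirac

open MeasureTheory Set Filter Topology
open scoped ContDiff ComplexConjugate

/-! ### Primitives and integration by parts on a bounded interval -/

/-! Integration by parts turns ⟨φ, Hψ⟩ - ⟨Hφ, ψ⟩ into a form in the boundary vectors Φ, Ψ ∈ ℂ⁴
(`inner_edgeOp_sub`), which is skew-Hermitian, nondegenerate and independent of k. Elements of the
adjoint domain lie in H² (`edge_regularity`), so they have boundary vectors, and every vector of ℂ⁴
is attained. Hence self-adjointness means that ker A is its own orthogonal complement for this form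
(`isSelfAdjoint_iff`). Counting dimensions, this is rank A = 2 together with A J Aᴴ = 0, where J is
`dualMatrix ε` (`lagrangian_iff`); both conditions survive A ↦ GA.

The matrix A₁ lives in the first two columns and the corresponding block of J is zero, so A(k) J
A(k)ᴴ is affine in k. If it vanishes for almost every k, both coefficients vanish (`IsotropicPair`).
When A₀ has rank 2, row reduction by a constant G, governed by the rank of the last two columns,
produces the shape of one of the classes 𝔄, and the isotropy equations become the constraints on the
remaining entries (`IsotropicPair.hasNormalForm`). Statement 2 is this result for the pencil with
constant term A(k) and linear term 0.

When A₀ has rank below 2, a constant factor clears one of its rows; that row of A(k) is then ik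
times a constant row, and division by ik moves it into the constant term. Either the new constant
term has rank 2, or A(k) is supported in the first two columns and is equivalent to [1 | 0] for
almost every k (`exists_inClass_of_ae`). So the classes 𝔄 suffice in the forward direction, and 𝔅, ℭ
matter only for the converse, where they have to be isotropic (`InClass.isotropicPair`). -/

theorem absolutelyContinuousOnInterval_const {F : Type*} [SeminormedAddCommGroup F] (c : F)
    (a b : ℝ) : AbsolutelyContinuousOnInterval (fun _ : ℝ => c) a b :=
  LipschitzOnWith.absolutelyContinuousOnInterval (K := 0)
    ((LipschitzWith.const c).lipschitzOnWith)

/-- Real and imaginary parts have absolutely continuous primitives; they are recombined as real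
multiples of 1 and I. -/
theorem absolutelyContinuousOnInterval_primitive {h : ℝ → ℂ} {a b : ℝ}
    (hh : IntervalIntegrable h volume a b) :
    AbsolutelyContinuousOnInterval (fun x => ∫ t in a..x, h t) a b := by
  have hre : IntervalIntegrable (fun t => (h t).re) volume a b :=
    ⟨hh.1.re, hh.2.re⟩
  have him : IntervalIntegrable (fun t => (h t).im) volume a b :=
    ⟨hh.1.im, hh.2.im⟩
  have h1 := (hre.absolutelyContinuousOnInterval_intervalIntegral (c := a) (by simp)).fun_smul
    (absolutelyContinuousOnInterval_const (1 : ℂ) a b)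
  have h2 := (him.absolutelyContinuousOnInterval_intervalIntegral (c := a) (by simp)).fun_smul
    (absolutelyContinuousOnInterval_const Complex.I a b)
  have h3 := h1.fun_add h2
  have key : ∀ x ∈ uIcc a b, (∫ t in a..x, (h t).re) • (1 : ℂ) + (∫ t in a..x, (h t).im) • Complex.I
      = ∫ t in a..x, h t := by
    intro x hx
    have hx' : IntervalIntegrable h volume a x := hh.mono_set (uIcc_subset_uIcc_left hx)
    rw [← intervalIntegral.integral_smul_const, ← intervalIntegral.integral_smul_const,
      ← intervalIntegral.integral_add]
    · refine intervalIntegral.integral_congr fun t _ => ?_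
      apply Complex.ext <;> simp
    · exact ⟨hx'.1.re.smul_const _, hx'.2.re.smul_const _⟩
    · exact ⟨hx'.1.im.smul_const _, hx'.2.im.smul_const _⟩
  rw [absolutelyContinuousOnInterval_iff] at h3 ⊢
  intro ε hε
  obtain ⟨δ, hδ, H⟩ := h3 ε hε
  refine ⟨δ, hδ, fun E hE hd => ?_⟩
  convert H E hE hd using 2 with i hi
  have := hE.1 i hi
  rw [key _ this.1, key _ this.2]

/-- Integration by parts for primitives of integrable complex functions. -/
theorem integral_mul_primitive_add {f g : ℝ → ℂ} {R : ℝ}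
    (hf : IntervalIntegrable f volume 0 R) (hg : IntervalIntegrable g volume 0 R) (a b : ℂ) :
    ∫ y in (0 : ℝ)..R, (f y * (b + ∫ t in (0 : ℝ)..y, g t) + (a + ∫ t in (0 : ℝ)..y, f t) * g y)
      = (a + ∫ t in (0 : ℝ)..R, f t) * (b + ∫ t in (0 : ℝ)..R, g t) - a * b := by
  set u : ℝ → ℂ := fun y => a + ∫ t in (0 : ℝ)..y, f t with hu
  set w : ℝ → ℂ := fun y => b + ∫ t in (0 : ℝ)..y, g t with hw
  have hua : AbsolutelyContinuousOnInterval u 0 R :=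
    (absolutelyContinuousOnInterval_const a 0 R).fun_add
      (absolutelyContinuousOnInterval_primitive hf)
  have hwa : AbsolutelyContinuousOnInterval w 0 R :=
    (absolutelyContinuousOnInterval_const b 0 R).fun_add
      (absolutelyContinuousOnInterval_primitive hg)
  have hi : IntervalIntegrable (fun y => f y * w y + u y * g y) volume 0 R :=
    (hf.mul_continuousOn hwa.continuousOn).add (hg.continuousOn_mul hua.continuousOn)
  -- The product u w minus the primitive of f w + u g is absolutely continuous with derivative 0
  -- almost everywhere, hence constant.
  have hac := (hua.fun_smul hwa).fun_sub (absolutelyContinuousOnInterval_primitive hi)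
  obtain ⟨C, hC⟩ := hac.const_of_ae_hasDerivAt_zero (by
    filter_upwards [hf.ae_hasDerivAt_integral, hg.ae_hasDerivAt_integral,
      hi.ae_hasDerivAt_integral] with x h1 h2 h3 hx
    have d1 : HasDerivAt u (f x) x := (h1 hx 0 (by simp)).const_add a
    have d2 : HasDerivAt w (g x) x := (h2 hx 0 (by simp)).const_add b
    have d := (d1.mul d2).sub (h3 hx 0 (by simp))
    rw [sub_self] at d
    exact d)
  have e0 := hC 0 (by simp)
  have e1 := hC R (by simp)
  simp only [smul_eq_mul] at e0 e1
  have u0 : u 0 = a := by simp [hu]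
  have w0 : w 0 = b := by simp [hw]
  rw [u0, w0, intervalIntegral.integral_same, sub_zero] at e0
  rw [← e0] at e1
  change ∫ y in (0 : ℝ)..R, (f y * w y + u y * g y) = u R * w R - a * b
  linear_combination -e1

/-! ### Test functions -/

theorem IsTest.exists_Icc {φ : ℝ → ℝ} (h : IsTest φ) :
    ∃ a b, 0 < a ∧ a ≤ b ∧ ∀ y, y ∉ Icc a b → φ y = 0 := by
  by_cases he : (tsupport φ).Nonempty
  · obtain ⟨a, ha, hmin⟩ := h.compact.isCompact.exists_isLeast he
    obtain ⟨b, hb, hmax⟩ := h.compact.isCompact.exists_isGreatest he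
    refine ⟨a, b, h.support ha, hmin hb, fun y hy => ?_⟩
    exact image_eq_zero_of_notMem_tsupport fun hy' => hy ⟨hmin hy', hmax hy'⟩
  · refine ⟨1, 1, one_pos, le_rfl, fun y _ => ?_⟩
    exact image_eq_zero_of_notMem_tsupport fun hy' => he ⟨y, hy'⟩

theorem IsTest.of_Icc {φ : ℝ → ℝ} {a b : ℝ} (hs : ContDiff ℝ ∞ φ) (ha : 0 < a)
    (h : ∀ y, y ∉ Icc a b → φ y = 0) : IsTest φ := by
  have hsub : tsupport φ ⊆ Icc a b :=
    closure_minimal (fun y hy => by_contra fun hy' => hy (h y hy')) isClosed_Icc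
  exact ⟨hs, HasCompactSupport.intro isCompact_Icc h, fun y hy => ha.trans_le (hsub hy).1⟩

theorem IsTest.deriv {φ : ℝ → ℝ} (h : IsTest φ) : IsTest (deriv φ) where
  smooth := (contDiff_infty_iff_deriv.1 h.smooth).2
  compact := h.compact.deriv
  support := (tsupport_deriv_subset).trans h.support

theorem IsTest.hasDerivAt {φ : ℝ → ℝ} (h : IsTest φ) (y : ℝ) : HasDerivAt φ (_root_.deriv φ y) y :=
  ((contDiff_infty_iff_deriv.1 h.smooth).1 y).hasDerivAt

theorem IsTest.continuous {φ : ℝ → ℝ} (h : IsTest φ) : Continuous φ := h.smooth.continuous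

theorem IsTest.add {φ χ : ℝ → ℝ} (hφ : IsTest φ) (hχ : IsTest χ) : IsTest (φ + χ) where
  smooth := hφ.smooth.add hχ.smooth
  compact := hφ.compact.add hχ.compact
  support := (tsupport_add φ χ).trans (union_subset hφ.support hχ.support)

theorem IsTest.const_smul {φ : ℝ → ℝ} (c : ℝ) (hφ : IsTest φ) : IsTest (c • φ) where
  smooth := hφ.smooth.const_smul c
  compact := hφ.compact.smul_left (f := fun _ => c)
  support := (tsupport_smul_subset_right (fun _ => c) φ).trans hφ.support

theorem contDiff_primitive {φ : ℝ → ℝ} (h : ContDiff ℝ ∞ φ) :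
    ContDiff ℝ ∞ (fun y => ∫ t in (0 : ℝ)..y, φ t) := by
  refine contDiff_infty_iff_deriv.2 ⟨fun y => ?_, ?_⟩
  · exact (h.continuous.integral_hasStrictDerivAt 0 y).hasDerivAt.differentiableAt
  · rw [funext (h.continuous.deriv_integral φ 0)]
    exact h

theorem IsTest.integral_halfLine {φ : ℝ → ℝ} (h : IsTest φ) (f : ℝ → ℂ) :
    ∫ y, φ y • f y ∂halfLine = ∫ y, φ y • f y := by
  refine setIntegral_eq_integral_of_forall_compl_eq_zero fun y hy => ?_
  rw [image_eq_zero_of_notMem_tsupport fun h' => hy (h.support h'), zero_smul]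

theorem exists_isTest_integral_eq_one : ∃ η : ℝ → ℝ, IsTest η ∧ ∫ y, η y = 1 := by
  let b : ContDiffBump (2 : ℝ) := ⟨1 / 2, 1, by norm_num, by norm_num⟩
  refine ⟨b.normed volume, ⟨b.contDiff_normed, b.hasCompactSupport_normed, ?_⟩, b.integral_normed⟩
  rw [b.tsupport_normed_eq]
  intro y hy
  rw [Metric.mem_closedBall, Real.dist_eq] at hy
  have := (abs_le.1 hy).1
  simp only [b] at this
  rw [mem_Ioi]
  linarith

/-- A test function of mean zero is the derivative of a test function. -/
theorem IsTest.exists_deriv_eq {φ : ℝ → ℝ} (h : IsTest φ) (h0 : ∫ y, φ y = 0) :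
    ∃ θ, IsTest θ ∧ _root_.deriv θ = φ := by
  obtain ⟨a, b, ha, hab, hz⟩ := h.exists_Icc
  refine ⟨fun y => ∫ t in (0 : ℝ)..y, φ t,
    IsTest.of_Icc (b := b) (contDiff_primitive h.smooth) ha ?_,
    funext (h.continuous.deriv_integral φ 0)⟩
  intro y hy
  rw [mem_Icc, not_and_or, not_le, not_le] at hy
  rcases hy with hy | hy
  · refine (intervalIntegral.integral_congr (g := fun _ => 0) fun t ht => ?_).trans (by simp)
    refine hz t fun ht' => ?_
    rw [mem_uIcc] at ht
    rcases ht with ht | ht <;> linarith [ht'.1]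
  · refine Eq.trans ?_ h0
    rw [intervalIntegral.integral_of_le (by linarith)]
    refine setIntegral_eq_integral_of_forall_compl_eq_zero fun t ht => hz t fun ht' => ht ?_
    exact ⟨ha.trans_le ht'.1, ht'.2.trans hy.le⟩

/-- The lemma of du Bois-Reymond on the half-line. -/
theorem exists_ae_eq_const_of_integral_deriv_smul_eq_zero {h : ℝ → ℂ}
    (hloc : LocallyIntegrableOn h (Ioi (0 : ℝ)) volume)
    (h0 : ∀ φ, IsTest φ → ∫ y, deriv φ y • h y ∂halfLine = 0) :
    ∃ c : ℂ, h =ᵐ[halfLine] fun _ => c := by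
  obtain ⟨η, hη, hη1⟩ := exists_isTest_integral_eq_one
  have hint : ∀ φ, IsTest φ → Integrable (fun y => φ y • h y) volume := by
    intro φ hφ
    have h1 : IntegrableOn h (tsupport φ) volume :=
      hloc.integrableOn_compact_subset hφ.support hφ.compact.isCompact
    have h2 : IntegrableOn (fun y => φ y • h y) (tsupport φ) volume :=
      h1.continuousOn_smul hφ.continuous.continuousOn hφ.compact.isCompact
    refine (integrableOn_iff_integrable_of_support_subset fun y hy => ?_).1 h2
    by_contra hn
    exact hy (by simp [image_eq_zero_of_notMem_tsupport hn])
  refine ⟨∫ y, η y • h y, ?_⟩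
  set c := ∫ y, η y • h y with hc
  have key := isOpen_Ioi.ae_eq_zero_of_integral_contDiff_smul_eq_zero (U := Ioi (0 : ℝ))
    (f := fun y => h y - c) (μ := volume)
    (hloc.sub ((locallyIntegrable_const c).locallyIntegrableOn _)) (by
    intro φ hφ hcs hs
    have ht : IsTest φ := ⟨hφ, hcs, hs⟩
    have htφ : Integrable φ volume := ht.continuous.integrable_of_hasCompactSupport hcs
    have htη : Integrable η volume := hη.continuous.integrable_of_hasCompactSupport hη.compact
    -- Subtracting (∫ φ) η leaves a function of mean zero, hence the derivative of a test function,
    -- on which h vanishes. This reads ∫ φ (h - c) = 0.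
    have hmean : ∫ y, (φ + (-∫ y, φ y) • η) y = 0 := by
      simp only [Pi.add_apply, Pi.smul_apply, smul_eq_mul]
      rw [integral_add htφ (htη.const_mul _), integral_const_mul, hη1]
      ring
    obtain ⟨θ, hθ, hθ'⟩ := (ht.add (hη.const_smul (-∫ y, φ y))).exists_deriv_eq hmean
    have e := h0 θ hθ
    rw [hθ.deriv.integral_halfLine, hθ'] at e
    have e2 : ∫ y, (φ + (-∫ y, φ y) • η) y • h y
        = (∫ y, φ y • h y) + (-∫ y, φ y) • ∫ y, η y • h y := by
      rw [← integral_smul, ← integral_add (hint φ ht) (by exact (hint η hη).smul (-∫ y, φ y))]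
      refine integral_congr_ae (Eventually.of_forall fun y => ?_)
      simp [add_smul, mul_smul]
    rw [e2, ← hc] at e
    simp_rw [smul_sub]
    rw [integral_sub (hint φ ht) (htφ.smul_const c), integral_smul_const]
    rw [neg_smul] at e
    exact (sub_eq_add_neg _ _).trans e)
  refine (ae_restrict_iff' measurableSet_Ioi).2 ?_
  filter_upwards [key] with y hy hy0
  exact sub_eq_zero.1 (hy hy0)

/-! ### Continuous representatives and boundary values -/

theorem memLp_indicator (g : L2) : MemLp ((Ioi (0 : ℝ)).indicator g) 2 volume :=
  (memLp_indicator_iff_restrict measurableSet_Ioi).2 (Lp.memLp g)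

theorem intervalIntegrable_indicator (g : L2) (a b : ℝ) :
    IntervalIntegrable ((Ioi (0 : ℝ)).indicator g) volume a b := by
  rw [intervalIntegrable_iff]
  have h : MemLp ((Ioi (0 : ℝ)).indicator g) 2 (volume.restrict (uIoc a b)) :=
    (memLp_indicator g).mono_measure Measure.restrict_le_self
  have : IsFiniteMeasure (volume.restrict (uIoc a b)) := ⟨by simp [uIoc]⟩
  exact h.integrable (by norm_num)

/-- The primitive of an `L²` function that vanishes at `0`. -/
noncomputable def primitive (g : L2) (y : ℝ) : ℂ := ∫ t in (0 : ℝ)..y, (Ioi (0 : ℝ)).indicator g t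

theorem continuous_primitive (g : L2) : Continuous (primitive g) :=
  intervalIntegral.continuous_primitive (intervalIntegrable_indicator g) 0

/-- Integration by parts on [0, b + 1]; φ is zero at both ends, so no boundary term is left. -/
theorem integral_deriv_smul_primitive {φ : ℝ → ℝ} (h : IsTest φ) (g : L2) :
    ∫ y, deriv φ y • primitive g y ∂halfLine = -∫ y, φ y • g y ∂halfLine := by
  obtain ⟨a, b, ha, hab, hz⟩ := h.exists_Icc
  have hz' : ∀ y, y ∉ Icc a b → deriv φ y = 0 := by
    intro y hy
    have : φ =ᶠ[𝓝 y] fun _ => 0 := by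
      filter_upwards [isClosed_Icc.isOpen_compl.mem_nhds hy] with z hzz using hz z hzz
    rw [this.deriv_eq, deriv_const]
  have hφ' : Continuous (fun y => ((deriv φ y : ℝ) : ℂ)) :=
    Complex.continuous_ofReal.comp h.deriv.continuous
  have h0 : φ 0 = 0 := hz 0 fun h => by linarith [h.1]
  have hb : φ (b + 1) = 0 := hz _ fun h => by linarith [h.2]
  have hprim : ∀ y : ℝ, (∫ t in (0 : ℝ)..y, ((deriv φ t : ℝ) : ℂ)) = φ y := by
    intro y
    rw [intervalIntegral.integral_eq_sub_of_hasDerivAt (f := fun y => ((φ y : ℝ) : ℂ))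
      (fun t _ => (h.hasDerivAt t).ofReal_comp) (hφ'.intervalIntegrable _ _), h0]
    simp
  have key := integral_mul_primitive_add (hφ'.intervalIntegrable 0 (b + 1))
    (intervalIntegrable_indicator g 0 (b + 1)) 0 0
  simp only [hprim, hb, zero_add, Complex.ofReal_zero, zero_mul, sub_zero] at key
  have hc1 : Continuous fun y => ((deriv φ y : ℝ) : ℂ) * primitive g y :=
    hφ'.mul (continuous_primitive g)
  have hi2 : IntervalIntegrable (fun y => (φ y : ℂ) * (Ioi (0 : ℝ)).indicator g y) volume
      0 (b + 1) :=
    (intervalIntegrable_indicator g _ _).continuousOn_mul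
      (Complex.continuous_ofReal.comp h.continuous).continuousOn
  change ∫ y in (0 : ℝ)..(b + 1), (((deriv φ y : ℝ) : ℂ) * primitive g y
    + (φ y : ℂ) * (Ioi (0 : ℝ)).indicator g y) = 0 at key
  rw [intervalIntegral.integral_add (hc1.intervalIntegrable _ _) hi2] at key
  have hb0 : 0 ≤ b + 1 := by linarith
  have e1 : ∫ y, deriv φ y • primitive g y ∂halfLine
      = ∫ y in (0 : ℝ)..(b + 1), ((deriv φ y : ℝ) : ℂ) * primitive g y := by
    rw [h.deriv.integral_halfLine, intervalIntegral.integral_of_le hb0]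
    simp only [Complex.real_smul]
    refine (setIntegral_eq_integral_of_forall_compl_eq_zero fun t ht => ?_).symm
    rw [hz' t fun ht' => ht ⟨ha.trans_le ht'.1, by linarith [ht'.2]⟩]
    simp
  have e2 : ∫ y, φ y • g y ∂halfLine
      = ∫ y in (0 : ℝ)..(b + 1), (φ y : ℂ) * (Ioi (0 : ℝ)).indicator g y := by
    rw [intervalIntegral.integral_of_le hb0]
    simp only [Complex.real_smul]
    have e3 : ∫ y in Ioi (0 : ℝ), (φ y : ℂ) * g y
        = ∫ y in Ioc (0 : ℝ) (b + 1), (φ y : ℂ) * g y := by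
      refine setIntegral_eq_of_subset_of_forall_sdiff_eq_zero measurableSet_Ioi
        Ioc_subset_Ioi_self fun t ht => ?_
      rw [hz t fun ht' => ht.2 ⟨ha.trans_le ht'.1, by linarith [ht'.2]⟩]
      simp
    refine e3.trans (setIntegral_congr_fun measurableSet_Ioc fun t ht => ?_)
    rw [indicator_of_mem (mem_Ioi.2 ht.1)]
  rw [e1, e2]
  exact eq_neg_of_add_eq_zero_left key

/-- The difference `f - primitive g` has distributional derivative zero, so du Bois-Reymond makes it
constant. -/
theorem IsWeakDeriv.exists_ae_eq {f g : L2} (h : IsWeakDeriv f g) :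
    ∃ a : ℂ, f =ᵐ[halfLine] fun y => a + primitive g y := by
  have hloc : LocallyIntegrableOn (fun y => f y - primitive g y) (Ioi (0 : ℝ)) volume := by
    refine LocallyIntegrableOn.sub ?_
      ((continuous_primitive g).locallyIntegrable.locallyIntegrableOn _)
    rw [locallyIntegrableOn_iff isOpen_Ioi.isLocallyClosed]
    intro K hK hKc
    have h : MemLp f 2 (volume.restrict K) :=
      (Lp.memLp f).mono_measure (Measure.restrict_mono hK le_rfl)
    have : IsFiniteMeasure (volume.restrict K) := ⟨by simpa using hKc.measure_lt_top⟩
    exact h.integrable (by norm_num)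
  obtain ⟨c, hc⟩ := exists_ae_eq_const_of_integral_deriv_smul_eq_zero hloc (by
    intro φ hφ
    simp_rw [smul_sub]
    rw [integral_sub (hφ.integrable_deriv f), h φ hφ, integral_deriv_smul_primitive hφ, sub_self]
    exact ((hφ.deriv.continuous.smul (continuous_primitive g)).integrable_of_hasCompactSupport
      hφ.compact.deriv.smul_right).integrableOn)
  refine ⟨c, ?_⟩
  filter_upwards [hc] with y hy
  rw [← hy]
  ring

theorem HasBoundaryValue.unique {f : L2} {a b : ℂ} (ha : HasBoundaryValue f a)
    (hb : HasBoundaryValue f b) : a = b := by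
  obtain ⟨u, hu, hfu, rfl⟩ := ha
  obtain ⟨v, hv, hfv, rfl⟩ := hb
  have h : u =ᵐ[volume.restrict (Ici (0 : ℝ))] v := by
    rw [← Measure.restrict_congr_set Ioi_ae_eq_Ici]
    exact hfu.symm.trans hfv
  exact Measure.eqOn_of_ae_eq h hu hv (by simp) self_mem_Ici

theorem IsWeakDeriv.exists_hasBoundaryValue {f g : L2} (h : IsWeakDeriv f g) :
    ∃ a, HasBoundaryValue f a := by
  obtain ⟨a, ha⟩ := h.exists_ae_eq
  refine ⟨a, _, (continuous_const.add (continuous_primitive g)).continuousOn, ha, ?_⟩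
  simp [primitive]

theorem IsWeakDeriv.ae_eq {f g : L2} (h : IsWeakDeriv f g) {a : ℂ} (ha : HasBoundaryValue f a) :
    f =ᵐ[halfLine] fun y => a + primitive g y := by
  obtain ⟨b, hb⟩ := h.exists_ae_eq
  have : HasBoundaryValue f b :=
    ⟨_, (continuous_const.add (continuous_primitive g)).continuousOn, hb, by simp [primitive]⟩
  rwa [ha.unique this]

theorem integral_conj_indicator (g : L2) (y : ℝ) :
    ∫ t in (0 : ℝ)..y, conj ((Ioi (0 : ℝ)).indicator g t) = conj (primitive g y) := by
  rw [primitive, intervalIntegral, intervalIntegral, map_sub, integral_conj, integral_conj]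

/-- Integration by parts on the half-line. -/
theorem IsWeakDeriv.inner_add_inner {f f' g g' : L2} (hf : IsWeakDeriv f f') (hg : IsWeakDeriv g g')
    {a b : ℂ} (ha : HasBoundaryValue f a) (hb : HasBoundaryValue g b) :
    inner ℂ f' g + inner ℂ f g' = -(conj a * b) := by
  set If := (Ioi (0 : ℝ)).indicator f'
  set Ig := (Ioi (0 : ℝ)).indicator g'
  set u : ℝ → ℂ := fun y => conj a + conj (primitive f' y)
  set w : ℝ → ℂ := fun y => b + primitive g' y
  have hfu : (fun y => conj (f y)) =ᵐ[halfLine] u := by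
    filter_upwards [hf.ae_eq ha] with y hy
    rw [hy, map_add]
  have hgw : g =ᵐ[halfLine] w := hg.ae_eq hb
  set P : ℝ → ℂ := fun y => conj (If y) * w y + u y * Ig y
  have hcI : ∀ A B, IntervalIntegrable (fun y => conj (If y)) volume A B := by
    intro A B
    have h := intervalIntegrable_indicator f' A B
    exact ⟨by simpa [IntegrableOn, If] using (Complex.conjCLE.toContinuousLinearMap.integrable_comp h.1),
      by simpa [IntegrableOn, If] using (Complex.conjCLE.toContinuousLinearMap.integrable_comp h.2)⟩
  have key : ∀ R : ℝ, ∫ y in (0 : ℝ)..R, P y = u R * w R - conj a * b := by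
    intro R
    have := integral_mul_primitive_add (hcI 0 R) (intervalIntegrable_indicator g' 0 R) (conj a) b
    simp only [If, integral_conj_indicator] at this
    exact this
  have i1 : Integrable (fun y => conj (f' y) * g y) halfLine := by
    have := L2.integrable_inner (𝕜 := ℂ) f' g
    simpa [mul_comm] using this
  have i2 : Integrable (fun y => conj (f y) * g' y) halfLine := by
    have := L2.integrable_inner (𝕜 := ℂ) f g'
    simpa [mul_comm] using this
  have i3 : Integrable (fun y => conj (f y) * g y) halfLine := by
    have := L2.integrable_inner (𝕜 := ℂ) f g
    simpa [mul_comm] using this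
  have hP : (fun y => conj (f' y) * g y + conj (f y) * g' y) =ᵐ[halfLine] P := by
    filter_upwards [hfu, hgw, ae_restrict_mem measurableSet_Ioi] with y h1 h2 hy
    simp only [P, If, Ig, indicator_of_mem hy]
    rw [h1, h2]
  have hPi : IntegrableOn P (Ioi 0) volume := (i1.add i2).congr hP
  have huw : IntegrableOn (fun y => u y * w y) (Ioi 0) volume := by
    refine i3.congr ?_
    filter_upwards [hfu, hgw] with y h1 h2
    rw [h1, h2]
  have lim1 := intervalIntegral_tendsto_integral_Ioi 0 hPi tendsto_id
  have lim2 : Tendsto (fun R => u R * w R) atTop (𝓝 ((∫ y in Ioi (0 : ℝ), P y) + conj a * b)) := by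
    refine (lim1.add_const (conj a * b)).congr fun R => ?_
    rw [id, key R]
    ring
  -- The product u w has a limit at infinity and is integrable, so the limit is 0: there is no
  -- boundary term at infinity.
  have hzero : (∫ y in Ioi (0 : ℝ), P y) + conj a * b = 0 := by
    have hat : IntegrableAtFilter (fun y => u y * w y) atTop volume := ⟨Ioi 0, Ioi_mem_atTop _, huw⟩
    refine hat.eq_zero_of_tendsto (fun s hs => ?_) lim2
    rcases mem_atTop_sets.1 hs with ⟨b, hb⟩
    rw [← top_le_iff, ← Real.volume_Ici (a := b)]
    exact measure_mono hb
  have e : inner ℂ f' g + inner ℂ f g' = ∫ y in Ioi (0 : ℝ), P y := by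
    rw [L2.inner_def, L2.inner_def, ← integral_congr_ae hP, integral_add i1 i2]
    simp [mul_comm]
  rw [e]
  exact eq_neg_of_add_eq_zero_left hzero

/-! ### Compactly supported functions as elements of `L²` -/

/-- A continuous function of compact support, restricted to the half-line, as an element of `L²`. -/
noncomputable def ofCompactSupport (u : ℝ → ℂ) (hc : Continuous u)
    (hs : HasCompactSupport u) : L2 :=
  (hc.memLp_of_hasCompactSupport hs : MemLp u 2 halfLine).toLp

theorem coeFn_ofCompactSupport {u : ℝ → ℂ} (hc : Continuous u) (hs : HasCompactSupport u) :
    ofCompactSupport u hc hs =ᵐ[halfLine] u :=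
  MemLp.coeFn_toLp _

/-- The function u need not vanish at 0; the test function does, so integrating by parts over the
whole line is enough. -/
theorem isWeakDeriv_ofCompactSupport {u : ℝ → ℂ} (hc : ContDiff ℝ 1 u) (hs : HasCompactSupport u) :
    IsWeakDeriv (ofCompactSupport u hc.continuous hs)
      (ofCompactSupport (deriv u) (hc.continuous_deriv le_rfl) hs.deriv) := by
  intro φ hφ
  have hae : ∀ {χ : ℝ → ℝ} {v : ℝ → ℂ} (hχ : IsTest χ) (hv : Continuous v)
      (hvs : HasCompactSupport v),
      ∫ y, χ y • ofCompactSupport v hv hvs y ∂halfLine = ∫ y, (χ y : ℂ) * v y := by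
    intro χ v hχ hv hvs
    refine (integral_congr_ae ?_).trans (hχ.integral_halfLine v)
    filter_upwards [coeFn_ofCompactSupport hv hvs] with y hy
    rw [hy]
  have hd : ∀ y, HasDerivAt u (deriv u y) y := fun y =>
    (hc.differentiable one_ne_zero y).hasDerivAt
  have hcφ := Complex.continuous_ofReal.comp hφ.continuous
  have hcφ' := Complex.continuous_ofReal.comp hφ.deriv.continuous
  have hc' := hc.continuous_deriv le_rfl
  rw [hae hφ.deriv, hae hφ,
    integral_mul_deriv_eq_deriv_mul_of_integrable (u := fun y => (φ y : ℂ)) (v := u)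
    (u' := fun y => ((deriv φ y : ℝ) : ℂ)) (fun y _ => (hφ.hasDerivAt y).ofReal_comp)
    (fun y _ => hd y) ((hcφ.mul hc').integrable_of_hasCompactSupport hs.deriv.mul_left)
    ((hcφ'.mul hc.continuous).integrable_of_hasCompactSupport hs.mul_left)
    ((hcφ.mul hc.continuous).integrable_of_hasCompactSupport hs.mul_left), neg_neg]

theorem HasBoundaryValue.ofCompactSupport {u : ℝ → ℂ} (hc : Continuous u)
    (hs : HasCompactSupport u) :
    HasBoundaryValue (ofCompactSupport u hc hs) (u 0) :=
  ⟨u, hc.continuousOn, coeFn_ofCompactSupport hc hs, rfl⟩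

/-- A real test function as an element of `L²`. -/
noncomputable def IsTest.toL2 {φ : ℝ → ℝ} (h : IsTest φ) : L2 :=
  EdgeDirac.ofCompactSupport (fun y => (φ y : ℂ)) (Complex.continuous_ofReal.comp h.continuous)
    (h.compact.comp_left Complex.ofReal_zero)

theorem IsTest.coeFn_toL2 {φ : ℝ → ℝ} (h : IsTest φ) : h.toL2 =ᵐ[halfLine] fun y => (φ y : ℂ) :=
  coeFn_ofCompactSupport _ _

theorem IsTest.inner_toL2 {φ : ℝ → ℝ} (h : IsTest φ) (f : L2) :
    inner ℂ h.toL2 f = ∫ y, φ y • f y ∂halfLine := by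
  rw [L2.inner_def]
  refine integral_congr_ae ?_
  filter_upwards [h.coeFn_toL2] with y hy
  rw [hy]
  simp [mul_comm]

theorem IsTest.norm_integral_smul_le {φ : ℝ → ℝ} (h : IsTest φ) (f : L2) :
    ‖∫ y, φ y • f y ∂halfLine‖ ≤ ‖f‖ * ‖h.toL2‖ := by
  rw [← h.inner_toL2, mul_comm]
  exact norm_inner_le_norm _ _

theorem IsTest.norm_toL2_sq {φ : ℝ → ℝ} (h : IsTest φ) : ‖h.toL2‖ ^ 2 = ∫ y, φ y ^ 2 := by
  have e : inner ℂ h.toL2 h.toL2 = ((∫ y, φ y ^ 2 : ℝ) : ℂ) := by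
    rw [h.inner_toL2]
    rw [integral_congr_ae (g := fun y => φ y • (φ y : ℂ)) (by
      filter_upwards [h.coeFn_toL2] with y hy
      rw [hy]), h.integral_halfLine]
    refine Eq.trans ?_ (integral_ofReal (𝕜 := ℂ) (f := fun y => φ y ^ 2))
    refine integral_congr_ae (Eventually.of_forall fun y => ?_)
    simp [pow_two]
  rw [inner_self_eq_norm_sq_to_K] at e
  exact Complex.ofReal_injective (by simpa using e)

theorem IsTest.weakDeriv_toL2 {φ : ℝ → ℝ} (h : IsTest φ) : IsWeakDeriv h.toL2 h.deriv.toL2 := by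
  have hc : ContDiff ℝ 1 (fun y => (φ y : ℂ)) :=
    Complex.ofRealCLM.contDiff.comp (h.smooth.of_le (by exact_mod_cast le_top))
  have hs : HasCompactSupport (fun y => (φ y : ℂ)) := h.compact.comp_left Complex.ofReal_zero
  have e : _root_.deriv (fun y => (φ y : ℂ)) = fun y => ((_root_.deriv φ y : ℝ) : ℂ) :=
    funext fun y => (h.hasDerivAt y).ofReal_comp.deriv
  have := isWeakDeriv_ofCompactSupport hc hs
  simp only [e] at this
  exact this

theorem IsTest.hasBoundaryValue_toL2 {φ : ℝ → ℝ} (h : IsTest φ) : HasBoundaryValue h.toL2 0 := by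
  have h0 : φ 0 = 0 := image_eq_zero_of_notMem_tsupport fun h' => lt_irrefl (0 : ℝ) (h.support h')
  have : HasBoundaryValue h.toL2 ((φ 0 : ℝ) : ℂ) := HasBoundaryValue.ofCompactSupport _ _
  rwa [h0, Complex.ofReal_zero] at this

/-! ### A criterion for the existence of the weak derivative -/

/-- The bound makes l factor through the range of J as a continuous functional; Hahn-Banach extends
it to E and Riesz represents it. The linear section s is arbitrary, since l vanishes on ker J. -/
theorem exists_inner_eq_of_abs_le {V E : Type*} [AddCommGroup V] [Module ℝ V]
    [NormedAddCommGroup E] [InnerProductSpace ℝ E] [CompleteSpace E]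
    (J : V →ₗ[ℝ] E) (l : V →ₗ[ℝ] ℝ) (C : ℝ) (h : ∀ v, |l v| ≤ C * ‖J v‖) :
    ∃ g : E, ∀ v, l v = inner ℝ g (J v) := by
  obtain ⟨s, hs⟩ := J.rangeRestrict.exists_rightInverse_of_surjective J.range_rangeRestrict
  have hJs : ∀ w : LinearMap.range J, J (s w) = w := fun w =>
    congrArg Subtype.val (LinearMap.congr_fun hs w)
  let L : StrongDual ℝ (LinearMap.range J) := (l ∘ₗ s).mkContinuous C fun w => by
    have := h (s w)
    rw [hJs] at this
    exact this
  obtain ⟨G, hG, -⟩ := exists_extension_norm_eq (LinearMap.range J) L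
  refine ⟨(InnerProductSpace.toDual ℝ E).symm G, fun v => ?_⟩
  rw [InnerProductSpace.toDual_symm_apply]
  have hv := hG ⟨J v, v, rfl⟩
  have hd : l (v - s ⟨J v, v, rfl⟩) = 0 := by
    have := h (v - s ⟨J v, v, rfl⟩)
    rw [map_sub J, hJs, sub_self, norm_zero, mul_zero] at this
    exact abs_eq_zero.1 (le_antisymm this (abs_nonneg _))
  rw [map_sub, sub_eq_zero] at hd
  rw [hd, hv]
  rfl

/-- The real vector space of test functions. -/
def testSpace : Submodule ℝ (ℝ → ℝ) where
  carrier := {φ | IsTest φ}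
  zero_mem' := ⟨contDiff_const, HasCompactSupport.zero, by simp⟩
  add_mem' := IsTest.add
  smul_mem' c _ h := IsTest.const_smul c h

/-- The inclusion of the test functions into `L²`. -/
noncomputable def testToL2 : testSpace →ₗ[ℝ] L2 where
  toFun φ := IsTest.toL2 φ.2
  map_add' φ χ := by
    refine Lp.ext ?_
    filter_upwards [IsTest.coeFn_toL2 (φ + χ).2, IsTest.coeFn_toL2 φ.2, IsTest.coeFn_toL2 χ.2,
      Lp.coeFn_add (IsTest.toL2 φ.2) (IsTest.toL2 χ.2)] with y h1 h2 h3 h4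
    rw [h1, h4, Pi.add_apply, h2, h3]
    simp
  map_smul' c φ := by
    refine Lp.ext ?_
    filter_upwards [IsTest.coeFn_toL2 (c • φ).2, IsTest.coeFn_toL2 φ.2,
      Lp.coeFn_smul c (IsTest.toL2 φ.2)] with y h1 h2 h3
    rw [h1, RingHom.id_apply, h3, Pi.smul_apply, h2]
    simp

/-- The functional `φ ↦ ∫ φ' f` on test functions. -/
noncomputable def pairDeriv (f : L2) : testSpace →ₗ[ℝ] ℂ where
  toFun φ := ∫ y, deriv (φ : ℝ → ℝ) y • f y ∂halfLine
  map_add' φ χ := by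
    rw [← integral_add (IsTest.integrable_deriv φ.2 f) (IsTest.integrable_deriv χ.2 f)]
    refine integral_congr_ae (Eventually.of_forall fun y => ?_)
    have : deriv ((φ + χ : testSpace) : ℝ → ℝ) y = deriv (φ : ℝ → ℝ) y + deriv (χ : ℝ → ℝ) y :=
      ((IsTest.hasDerivAt φ.2 y).add (IsTest.hasDerivAt χ.2 y)).deriv
    simp only [this, add_smul]
  map_smul' c φ := by
    rw [RingHom.id_apply, ← integral_smul]
    refine integral_congr_ae (Eventually.of_forall fun y => ?_)
    have : deriv ((c • φ : testSpace) : ℝ → ℝ) y = c • deriv (φ : ℝ → ℝ) y :=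
      ((IsTest.hasDerivAt φ.2 y).const_smul c).deriv
    simp only [this, smul_assoc]

theorem IsTest.inner_real_toL2 {φ : ℝ → ℝ} (h : IsTest φ) (g : L2) :
    inner ℝ g h.toL2 = (∫ y, φ y • g y ∂halfLine).re := by
  rw [L2.inner_def, ← RCLike.re_eq_complex_re, ← integral_re (h.integrable g)]
  refine integral_congr_ae ?_
  filter_upwards [h.coeFn_toL2] with y hy
  rw [hy, Complex.inner]
  simp

/-- A function in `L²` whose distributional derivative is bounded in `L²` has a weak derivative. -/
theorem exists_isWeakDeriv_of_norm_le {f : L2} {C : ℝ}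
    (h : ∀ φ (hφ : IsTest φ), ‖∫ y, deriv φ y • f y ∂halfLine‖ ≤ C * ‖hφ.toL2‖) :
    ∃ g, IsWeakDeriv f g := by
  -- Test functions are real, so the real and imaginary parts of φ ↦ ∫ φ' f are represented
  -- separately, and only the real parts of g₁ and g₂ enter.
  obtain ⟨g₁, hg₁⟩ := exists_inner_eq_of_abs_le testToL2 (Complex.reLm ∘ₗ pairDeriv f) C
    fun φ => (Complex.abs_re_le_norm _).trans (h φ φ.2)
  obtain ⟨g₂, hg₂⟩ := exists_inner_eq_of_abs_le testToL2 (Complex.imLm ∘ₗ pairDeriv f) C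
    fun φ => (Complex.abs_im_le_norm _).trans (h φ φ.2)
  have hre : ∀ g : L2, MemLp (fun y => ((g y).re : ℂ)) 2 halfLine := fun g =>
    (Complex.ofRealCLM.comp Complex.reCLM).comp_memLp' (Lp.memLp g)
  have hm : MemLp (fun y => ((g₁ y).re : ℂ) + Complex.I * ((g₂ y).re : ℂ)) 2 halfLine :=
    (hre g₁).add ((hre g₂).const_mul Complex.I)
  obtain ⟨G, hG⟩ : ∃ G : L2, G =ᵐ[halfLine] fun y => ((g₁ y).re : ℂ) + Complex.I * ((g₂ y).re : ℂ) :=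
    ⟨hm.toLp, hm.coeFn_toLp⟩
  refine ⟨-G, fun φ hφ => ?_⟩
  have e1 := hg₁ ⟨φ, hφ⟩
  have e2 := hg₂ ⟨φ, hφ⟩
  replace e1 : (∫ y, deriv φ y • f y ∂halfLine).re = (∫ y, φ y • g₁ y ∂halfLine).re :=
    e1.trans (hφ.inner_real_toL2 g₁)
  replace e2 : (∫ y, deriv φ y • f y ∂halfLine).im = (∫ y, φ y • g₂ y ∂halfLine).re :=
    e2.trans (hφ.inner_real_toL2 g₂)
  have e3 : ∫ y, φ y • (-G : L2) y ∂halfLine = -∫ y, φ y • G y ∂halfLine := by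
    rw [← integral_neg]
    refine integral_congr_ae ?_
    filter_upwards [Lp.coeFn_neg G] with y hy
    rw [hy, Pi.neg_apply, smul_neg]
  have e4 : (fun y => φ y • G y) =ᵐ[halfLine]
      fun y => φ y • (((g₁ y).re : ℂ) + Complex.I * ((g₂ y).re : ℂ)) := by
    filter_upwards [hG] with y hy
    rw [hy]
  have hi := hφ.integrable G
  rw [e3, neg_neg]
  apply Complex.ext
  · rw [e1, ← RCLike.re_eq_complex_re, ← integral_re (hφ.integrable g₁), ← integral_re hi]
    refine integral_congr_ae ?_
    filter_upwards [e4] with y hy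
    rw [hy]
    simp
  · rw [e2, ← RCLike.re_eq_complex_re, ← RCLike.im_eq_complex_im, ← integral_re (hφ.integrable g₂),
      ← integral_im hi]
    refine integral_congr_ae ?_
    filter_upwards [e4] with y hy
    rw [hy]
    simp

/-! ### Averages of test functions -/

theorem IsTest.comp_sub_one {φ : ℝ → ℝ} (h : IsTest φ) : IsTest (fun y => φ (y - 1)) := by
  obtain ⟨a, b, ha, hab, hz⟩ := h.exists_Icc
  refine IsTest.of_Icc (a := a) (b := b + 1) (h.smooth.comp (contDiff_id.sub contDiff_const)) ha
    fun y hy => hz _ fun hy' => hy ?_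
  exact ⟨by linarith [hy'.1], by linarith [hy'.2]⟩

/-- Cauchy-Schwarz, read off from 0 ≤ ∫ (φ - c κ)² with c the left-hand integral and ∫ κ² ≤ 1. -/
theorem sq_integral_mul_le {κ φ : ℝ → ℝ} (hκ : Continuous κ) (hφ : Continuous φ)
    (h1 : ∀ t ∈ Icc (0 : ℝ) 1, κ t ^ 2 ≤ 1) (y : ℝ) :
    (∫ t in (0 : ℝ)..1, κ t * φ (y - t)) ^ 2 ≤ ∫ t in (0 : ℝ)..1, φ (y - t) ^ 2 := by
  set c := ∫ t in (0 : ℝ)..1, κ t * φ (y - t) with hc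
  have hφy : Continuous fun t => φ (y - t) := hφ.comp (continuous_const.sub continuous_id)
  have hk : ∫ t in (0 : ℝ)..1, κ t ^ 2 ≤ 1 := by
    calc ∫ t in (0 : ℝ)..1, κ t ^ 2 ≤ ∫ t in (0 : ℝ)..1, (1 : ℝ) :=
          intervalIntegral.integral_mono_on zero_le_one ((hκ.pow 2).intervalIntegrable _ _)
            (by simp) h1
      _ = 1 := by simp
  have h0 : 0 ≤ ∫ t in (0 : ℝ)..1, (φ (y - t) - c * κ t) ^ 2 :=
    intervalIntegral.integral_nonneg zero_le_one fun t _ => sq_nonneg _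
  have e : ∫ t in (0 : ℝ)..1, (φ (y - t) - c * κ t) ^ 2
      = (∫ t in (0 : ℝ)..1, φ (y - t) ^ 2) - 2 * c * c + c ^ 2 * ∫ t in (0 : ℝ)..1, κ t ^ 2 := by
    have e2 : 2 * c * c = ∫ t in (0 : ℝ)..1, 2 * c * (κ t * φ (y - t)) := by
      rw [intervalIntegral.integral_const_mul]
    clear_value c
    rw [e2, ← intervalIntegral.integral_const_mul,
      ← intervalIntegral.integral_sub, ← intervalIntegral.integral_add]
    · refine intervalIntegral.integral_congr fun t _ => ?_
      ring
    all_goals exact Continuous.intervalIntegrable (by fun_prop) _ _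
  nlinarith [sq_nonneg c]

/-- The inner integral is the convolution of g with the indicator of (0, 1], which has integral 1.
-/
theorem integral_integral_comp_sub {g : ℝ → ℝ} (hg : Integrable g) :
    Integrable (fun y => ∫ t in (0 : ℝ)..1, g (y - t)) ∧
      ∫ y, (∫ t in (0 : ℝ)..1, g (y - t)) = ∫ y, g y := by
  set f : ℝ → ℝ := (Ioc (0 : ℝ) 1).indicator fun _ => 1 with hf
  have hfi : Integrable f := by
    rw [hf, integrable_indicator_iff measurableSet_Ioc]
    exact integrableOn_const (by simp)
  have e : (fun y => ∫ t in (0 : ℝ)..1, g (y - t))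
      = convolution f g (ContinuousLinearMap.mul ℝ ℝ) volume := by
    funext y
    rw [intervalIntegral.integral_of_le zero_le_one, convolution,
      ← integral_indicator measurableSet_Ioc]
    refine integral_congr_ae (Eventually.of_forall fun t => ?_)
    by_cases ht : t ∈ Ioc (0 : ℝ) 1 <;> simp [hf, ht]
  rw [e]
  refine ⟨hfi.integrable_convolution _ hg, ?_⟩
  rw [integral_convolution _ hfi hg]
  simp [hf, integral_indicator measurableSet_Ioc]

theorem norm_toL2_average_le {κ φ ψ : ℝ → ℝ} (hκ : Continuous κ) (hφ : IsTest φ) (hψ : IsTest ψ)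
    (h1 : ∀ t ∈ Icc (0 : ℝ) 1, κ t ^ 2 ≤ 1)
    (h : ∀ y, ψ y = ∫ t in (0 : ℝ)..1, κ t * φ (y - t)) : ‖hψ.toL2‖ ≤ ‖hφ.toL2‖ := by
  refine (sq_le_sq₀ (norm_nonneg _) (norm_nonneg _)).1 ?_
  rw [hψ.norm_toL2_sq, hφ.norm_toL2_sq]
  have hi : ∀ {χ : ℝ → ℝ}, IsTest χ → Integrable fun y => χ y ^ 2 := by
    intro χ hχ
    simp only [pow_two]
    exact (hχ.continuous.mul hχ.continuous).integrable_of_hasCompactSupport hχ.compact.mul_left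
  obtain ⟨hj, he⟩ := integral_integral_comp_sub (hi hφ)
  rw [← he]
  refine integral_mono (hi hψ) hj fun y => ?_
  simp only
  rw [h y]
  exact sq_integral_mul_le hκ hφ.continuous h1 y

theorem IsTest.norm_toL2_comp_sub_one {φ : ℝ → ℝ} (h : IsTest φ) :
    ‖h.comp_sub_one.toL2‖ = ‖h.toL2‖ := by
  rw [← sq_eq_sq₀ (norm_nonneg _) (norm_nonneg _), norm_toL2_sq, norm_toL2_sq]
  exact integral_sub_right_eq_self (fun y => φ y ^ 2) 1

/-- Up to terms bounded in `L²`, the derivative of a test function is the second derivative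
of another one. -/
theorem IsTest.exists_average {φ : ℝ → ℝ} (h : IsTest φ) :
    ∃ (ψ σ : ℝ → ℝ) (hψ : IsTest ψ) (hσ : IsTest σ),
      (∀ y, _root_.deriv ψ y = φ y - σ y) ∧
      (∀ y, _root_.deriv σ y = φ y - φ (y - 1)) ∧
      ‖hψ.toL2‖ ≤ ‖h.toL2‖ ∧ ‖hσ.toL2‖ ≤ ‖h.toL2‖ := by
  obtain ⟨a, b, ha, hab, hz⟩ := h.exists_Icc
  set Φ : ℝ → ℝ := fun y => ∫ t in (0 : ℝ)..y, φ t with hΦ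
  set Θ : ℝ → ℝ := fun y => ∫ t in (0 : ℝ)..y, Φ t with hΘ
  have sΦ : ContDiff ℝ ∞ Φ := contDiff_primitive h.smooth
  have sΘ : ContDiff ℝ ∞ Θ := contDiff_primitive sΦ
  have dΦ : ∀ y, HasDerivAt Φ (φ y) y := fun y =>
    (h.continuous.integral_hasStrictDerivAt 0 y).hasDerivAt
  have dΘ : ∀ y, HasDerivAt Θ (Φ y) y := fun y =>
    (sΦ.continuous.integral_hasStrictDerivAt 0 y).hasDerivAt
  have dsub : ∀ y : ℝ, HasDerivAt (fun y : ℝ => y - 1) 1 y := fun y => (hasDerivAt_id y).sub_const 1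
  -- Both are averages of t ↦ φ(y - t) over [0, 1]: σ with weight 1, ψ with weight 1 - t. The
  -- weights are at most 1, whence the norm bounds. Since ψ' = φ - σ, the function ψ'' differs from
  -- φ' only by φ(y) - φ(y - 1), which contains no derivative.
  set σ : ℝ → ℝ := fun y => Φ y - Φ (y - 1) with hσdef
  set ψ : ℝ → ℝ := fun y => Φ y - (Θ y - Θ (y - 1)) with hψdef
  have drev : ∀ y t : ℝ, HasDerivAt (fun t : ℝ => y - t) (-1) t := fun y t =>
    (hasDerivAt_id t).const_sub y
  have eσ : ∀ y, σ y = ∫ t in (0 : ℝ)..1, (1 : ℝ) * φ (y - t) := by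
    intro y
    rw [intervalIntegral.integral_eq_sub_of_hasDerivAt (f := fun t => -Φ (y - t))]
    · simp only [hσdef, sub_zero]; ring
    · intro t _
      have h1 := ((dΦ (y - t)).comp t (drev y t)).neg
      rw [mul_neg_one, neg_neg, ← one_mul (φ (y - t))] at h1
      exact h1
    · exact Continuous.intervalIntegrable
        (continuous_const.mul (h.continuous.comp (continuous_const.sub continuous_id))) _ _
  have eψ : ∀ y, ψ y = ∫ t in (0 : ℝ)..1, (1 - t) * φ (y - t) := by
    intro y
    rw [intervalIntegral.integral_eq_sub_of_hasDerivAt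
      (f := fun t => -((1 - t) * Φ (y - t)) + Θ (y - t))]
    · simp only [hψdef, sub_zero, sub_self]; ring
    · intro t _
      have h1 := ((drev 1 t).mul ((dΦ (y - t)).comp t (drev y t))).neg.add
        ((dΘ (y - t)).comp t (drev y t))
      exact h1.congr_deriv (by simp only [Function.comp_apply]; ring)
    · exact Continuous.intervalIntegrable ((continuous_const.sub continuous_id).mul
        (h.continuous.comp (continuous_const.sub continuous_id))) _ _
  have vanish : ∀ κ : ℝ → ℝ, ∀ y, y ∉ Icc a (b + 1) →
      ∫ t in (0 : ℝ)..1, κ t * φ (y - t) = 0 := by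
    intro κ y hy
    refine (intervalIntegral.integral_congr (g := fun _ => 0) fun t ht => ?_).trans (by simp)
    rw [uIcc_of_le zero_le_one] at ht
    have : φ (y - t) = 0 := hz _ fun h' => hy ⟨by linarith [h'.1, ht.1], by linarith [h'.2, ht.2]⟩
    simp [this]
  have tσ : IsTest σ := IsTest.of_Icc (b := b + 1)
    (sΦ.sub (sΦ.comp (contDiff_id.sub contDiff_const))) ha
    fun y hy => by rw [eσ y]; exact vanish (fun _ => 1) y hy
  have tψ : IsTest ψ := IsTest.of_Icc (b := b + 1)
    (sΦ.sub (sΘ.sub (sΘ.comp (contDiff_id.sub contDiff_const)))) ha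
    fun y hy => by rw [eψ y]; exact vanish (fun t => 1 - t) y hy
  refine ⟨ψ, σ, tψ, tσ, fun y => ?_, fun y => ?_,
    norm_toL2_average_le (continuous_const.sub continuous_id) h tψ (fun t ht => ?_) eψ,
    norm_toL2_average_le continuous_const h tσ (by simp) eσ⟩
  · have := ((dΦ y).sub ((dΘ y).sub ((dΘ (y - 1)).comp y (dsub y)))).deriv
    rw [mul_one] at this
    exact this
  · have := ((dΦ y).sub ((dΦ (y - 1)).comp y (dsub y))).deriv
    rw [mul_one] at this
    exact this
  · have h1 := ht.1
    have h2 := ht.2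
    change (1 - t) ^ 2 ≤ 1
    nlinarith

/-- Interior regularity, first step: if `f'' = -g' + F` in the sense of distributions with
`f, g, F ∈ L²`, then `f'` is in `L²`. -/
theorem exists_isWeakDeriv_of_second_order {f g F : L2}
    (h : ∀ φ, IsTest φ → ∫ y, deriv (deriv φ) y • f y ∂halfLine
      = ∫ y, deriv φ y • g y ∂halfLine + ∫ y, φ y • F y ∂halfLine) :
    ∃ f', IsWeakDeriv f f' := by
  -- Testing the equation with ψ instead of φ leaves ∫ φ' f on one side. In the constant, g is
  -- paired with φ and σ, F with ψ, and f with φ and its translate.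
  refine exists_isWeakDeriv_of_norm_le (C := 2 * ‖g‖ + ‖F‖ + 2 * ‖f‖) fun φ hφ => ?_
  obtain ⟨ψ, σ, hψ, hσ, dψ, dσ, nψ, nσ⟩ := hφ.exists_average
  have d2 : ∀ y, deriv (deriv ψ) y = deriv φ y - (φ y - φ (y - 1)) := by
    intro y
    rw [funext dψ, ← dσ y]
    exact ((hφ.hasDerivAt y).sub (hσ.hasDerivAt y)).deriv
  have e := h ψ hψ
  simp only [d2, dψ, sub_smul] at e
  rw [integral_sub (hφ.integrable_deriv f) (by
      exact (hφ.integrable f).sub (hφ.comp_sub_one.integrable f)),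
    integral_sub (hφ.integrable f) (hφ.comp_sub_one.integrable f),
    integral_sub (hφ.integrable g) (hσ.integrable g)] at e
  have e' : ∫ y, deriv φ y • f y ∂halfLine
      = (∫ y, φ y • f y ∂halfLine - ∫ y, φ (y - 1) • f y ∂halfLine)
        + (∫ y, φ y • g y ∂halfLine - ∫ y, σ y • g y ∂halfLine)
        + ∫ y, ψ y • F y ∂halfLine := by
    linear_combination e
  rw [e']
  have b1 := hφ.norm_integral_smul_le f
  have b2 := hφ.comp_sub_one.norm_integral_smul_le f
  rw [hφ.norm_toL2_comp_sub_one] at b2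
  have b3 := hφ.norm_integral_smul_le g
  have b4 := (hσ.norm_integral_smul_le g).trans (mul_le_mul_of_nonneg_left nσ (norm_nonneg _))
  have b5 := (hψ.norm_integral_smul_le F).trans (mul_le_mul_of_nonneg_left nψ (norm_nonneg _))
  refine (norm_add₃_le).trans ?_
  have c1 := norm_sub_le (∫ y, φ y • f y ∂halfLine) (∫ y, φ (y - 1) • f y ∂halfLine)
  have c2 := norm_sub_le (∫ y, φ y • g y ∂halfLine) (∫ y, σ y • g y ∂halfLine)
  linarith

/-! ### Green's formula -/

/-- The boundary form of `H♯(k)`, in terms of the boundary vectors. -/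
noncomputable def boundaryForm (ε : ℝ) (Φ Ψ : Fin 4 → ℂ) : ℂ :=
  -ε * (conj (Φ 0) * Ψ 2 - conj (Φ 2) * Ψ 0) + ε * (conj (Φ 1) * Ψ 3 - conj (Φ 3) * Ψ 1)
    - (conj (Φ 0) * Ψ 1 - conj (Φ 1) * Ψ 0)

/-- The differential expression `H♯(k)` without boundary condition. -/
noncomputable def edgeOp (m ε k : ℝ) (ψ : Spinor) : Spinor :=
  WithLp.toLp 2 (edgeFst m ε k ψ, edgeSnd m ε k ψ)

theorem spinor_inner (φ ψ : Spinor) :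
    inner ℂ φ ψ = inner ℂ φ.fst ψ.fst + inner ℂ φ.snd ψ.snd := rfl

theorem spinor_ext {φ ψ : Spinor} (h₁ : φ.fst = ψ.fst) (h₂ : φ.snd = ψ.snd) : φ = ψ :=
  congrArg (WithLp.toLp 2) (Prod.ext h₁ h₂)

theorem spinor_fst (f g : L2) : (WithLp.toLp 2 (f, g)).fst = f := rfl

theorem spinor_snd (f g : L2) : (WithLp.toLp 2 (f, g)).snd = g := rfl

/-- Two integrations by parts for each second derivative and one for each first-order coupling. The
terms of order zero cancel because their coefficients are real and symmetric, so k drops out. -/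
theorem inner_edgeOp_sub (m ε k : ℝ) {φ ψ : Spinor} {Φ Ψ : Fin 4 → ℂ}
    (hφ₁ : φ.fst ∈ H2) (hφ₂ : φ.snd ∈ H2) (hψ₁ : ψ.fst ∈ H2) (hψ₂ : ψ.snd ∈ H2)
    (hΦ : HasBoundaryVector φ Φ) (hΨ : HasBoundaryVector ψ Ψ) :
    inner ℂ φ (edgeOp m ε k ψ) - inner ℂ (edgeOp m ε k φ) ψ = boundaryForm ε Φ Ψ := by
  obtain ⟨p, p', hp, hp'⟩ := hφ₁
  obtain ⟨q, q', hq, hq'⟩ := hφ₂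
  obtain ⟨r, r', hr, hr'⟩ := hψ₁
  obtain ⟨s, s', hs, hs'⟩ := hψ₂
  obtain ⟨a0, a1, a2, a3⟩ := hΦ
  obtain ⟨b0, b1, b2, b3⟩ := hΨ
  rw [weakDeriv_eq hp] at a2
  rw [weakDeriv_eq hq] at a3
  rw [weakDeriv_eq hr] at b2
  rw [weakDeriv_eq hs] at b3
  have e1 := hp'.inner_add_inner hr a2 b0
  have e2 := hp.inner_add_inner hr' a0 b2
  have e3 := hq'.inner_add_inner hs a3 b1
  have e4 := hq.inner_add_inner hs' a1 b3
  have e5 := hp.inner_add_inner hs a0 b1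
  have e6 := hq.inner_add_inner hr a1 b0
  simp only [edgeOp, edgeFst, edgeSnd, spinor_inner, spinor_fst, spinor_snd, weakDeriv_eq hp,
    weakDeriv_eq hp',
    weakDeriv_eq hq, weakDeriv_eq hq', weakDeriv_eq hr, weakDeriv_eq hr', weakDeriv_eq hs,
    weakDeriv_eq hs', inner_add_left, inner_add_right, inner_sub_left, inner_sub_right,
    inner_smul_left, inner_smul_right, map_neg, Complex.conj_ofReal, boundaryForm]
  linear_combination (-(ε : ℂ)) * e1 + ε * e2 + ε * e3 - ε * e4 + e5 - e6

/-! ### Boundary vectors -/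

theorem mem_H2_exists_boundaryValues {f : L2} (h : f ∈ H2) :
    ∃ a b, HasBoundaryValue f a ∧ HasBoundaryValue (weakDeriv f) b := by
  obtain ⟨f', f'', h1, h2⟩ := h
  obtain ⟨a, ha⟩ := h1.exists_hasBoundaryValue
  obtain ⟨b, hb⟩ := h2.exists_hasBoundaryValue
  exact ⟨a, b, ha, by rwa [weakDeriv_eq h1]⟩

theorem exists_hasBoundaryVector {φ : Spinor} (h₁ : φ.fst ∈ H2) (h₂ : φ.snd ∈ H2) :
    ∃ Φ, HasBoundaryVector φ Φ := by
  obtain ⟨a, b, ha, hb⟩ := mem_H2_exists_boundaryValues h₁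
  obtain ⟨c, d, hc, hd⟩ := mem_H2_exists_boundaryValues h₂
  exact ⟨![a, c, b, d], ha, hc, hb, hd⟩

theorem HasBoundaryVector.unique {φ : Spinor} {Φ Ψ : Fin 4 → ℂ} (h : HasBoundaryVector φ Φ)
    (h' : HasBoundaryVector φ Ψ) : Φ = Ψ := by
  funext i
  fin_cases i
  · exact h.val₁.unique h'.val₁
  · exact h.val₂.unique h'.val₂
  · exact h.der₁.unique h'.der₁
  · exact h.der₂.unique h'.der₂

/-- The affine function a + b y, cut off by a bump function equal to 1 near 0. -/
theorem exists_mem_H2_boundaryValues (a b : ℂ) :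
    ∃ f ∈ H2, HasBoundaryValue f a ∧ HasBoundaryValue (weakDeriv f) b := by
  let χ : ContDiffBump (0 : ℝ) := ⟨1, 2, by norm_num, by norm_num⟩
  set u : ℝ → ℂ := fun y => (a + b * (y : ℂ)) * ((χ y : ℝ) : ℂ) with hu
  have hlin : ContDiff ℝ 2 fun y : ℝ => a + b * (y : ℂ) :=
    contDiff_const.add (contDiff_const.mul Complex.ofRealCLM.contDiff)
  have hc : ContDiff ℝ 2 u := hlin.mul (Complex.ofRealCLM.contDiff.comp χ.contDiff)
  have hs : HasCompactSupport u :=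
    (χ.hasCompactSupport.comp_left (g := fun x : ℝ => (x : ℂ)) Complex.ofReal_zero).mul_left
  have hc1 : ContDiff ℝ 1 u := hc.of_le (by norm_num)
  have hc' : ContDiff ℝ 1 (deriv u) := (contDiff_succ_iff_deriv.1 hc).2.2
  have h1 := isWeakDeriv_ofCompactSupport hc1 hs
  have h2 := isWeakDeriv_ofCompactSupport hc' hs.deriv
  have hnear : u =ᶠ[𝓝 0] fun y => a + b * (y : ℂ) := by
    filter_upwards [χ.eventuallyEq_one] with y hy
    simp [hu, hy]
  have u0 : u 0 = a := by simpa using hnear.eq_of_nhds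
  have u1 : deriv u 0 = b := by
    rw [hnear.deriv_eq]
    have := (((Complex.ofRealCLM.hasDerivAt (x := (0 : ℝ))).const_mul b).const_add a).deriv
    simpa using this
  refine ⟨_, ⟨_, _, h1, h2⟩, ?_, ?_⟩
  · exact u0 ▸ HasBoundaryValue.ofCompactSupport hc.continuous hs
  · rw [weakDeriv_eq h1]
    exact u1 ▸ HasBoundaryValue.ofCompactSupport (hc1.continuous_deriv le_rfl) hs.deriv

theorem exists_spinor_hasBoundaryVector (Φ : Fin 4 → ℂ) :
    ∃ φ : Spinor, φ.fst ∈ H2 ∧ φ.snd ∈ H2 ∧ HasBoundaryVector φ Φ := by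
  obtain ⟨f, hf, h0, h2⟩ := exists_mem_H2_boundaryValues (Φ 0) (Φ 2)
  obtain ⟨g, hg, h1, h3⟩ := exists_mem_H2_boundaryValues (Φ 1) (Φ 3)
  exact ⟨WithLp.toLp 2 (f, g), hf, hg, h0, h1, h2, h3⟩

/-! ### Test spinors and density of the domain -/

theorem weakDeriv_zero : weakDeriv 0 = 0 := weakDeriv_eq IsWeakDeriv.zero

theorem IsTest.toL2_mem_H2 {χ : ℝ → ℝ} (h : IsTest χ) : h.toL2 ∈ H2 :=
  ⟨_, _, h.weakDeriv_toL2, h.deriv.weakDeriv_toL2⟩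

theorem IsTest.fst_mem_edgeDomain {χ : ℝ → ℝ} (h : IsTest χ) (A : Matrix (Fin 2) (Fin 4) ℂ) :
    WithLp.toLp 2 (h.toL2, (0 : L2)) ∈ edgeDomain A := by
  refine ⟨h.toL2_mem_H2, H2.zero_mem, 0, ⟨h.hasBoundaryValue_toL2, HasBoundaryValue.zero, ?_, ?_⟩,
    Matrix.mulVec_zero A⟩
  · rw [spinor_fst, weakDeriv_eq h.weakDeriv_toL2]; exact h.deriv.hasBoundaryValue_toL2
  · rw [spinor_snd, weakDeriv_zero]; exact HasBoundaryValue.zero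

theorem IsTest.snd_mem_edgeDomain {χ : ℝ → ℝ} (h : IsTest χ) (A : Matrix (Fin 2) (Fin 4) ℂ) :
    WithLp.toLp 2 ((0 : L2), h.toL2) ∈ edgeDomain A := by
  refine ⟨H2.zero_mem, h.toL2_mem_H2, 0, ⟨HasBoundaryValue.zero, h.hasBoundaryValue_toL2, ?_, ?_⟩,
    Matrix.mulVec_zero A⟩
  · rw [spinor_fst, weakDeriv_zero]; exact HasBoundaryValue.zero
  · rw [spinor_snd, weakDeriv_eq h.weakDeriv_toL2]; exact h.deriv.hasBoundaryValue_toL2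

/-- Orthogonality to all test functions says that f is a weak derivative of 0, and weak derivatives
are unique. -/
theorem eq_zero_of_inner_toL2 {f : L2} (h : ∀ χ (hχ : IsTest χ), inner ℂ hχ.toL2 f = 0) : f = 0 := by
  refine IsWeakDeriv.unique (f := 0) (fun χ hχ => ?_) IsWeakDeriv.zero
  rw [← hχ.inner_toL2, h χ hχ, ← hχ.deriv.inner_toL2, inner_zero_right, neg_zero]

/-- Test spinors have zero boundary vector, so they satisfy every boundary condition. -/
theorem dense_edgeDomain (A : Matrix (Fin 2) (Fin 4) ℂ) : Dense (edgeDomain A : Set Spinor) := by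
  rw [Submodule.dense_iff_topologicalClosure_eq_top, Submodule.topologicalClosure_eq_top_iff,
    Submodule.eq_bot_iff]
  intro φ hφ
  rw [Submodule.mem_orthogonal] at hφ
  have h1 : φ.fst = 0 := eq_zero_of_inner_toL2 fun χ hχ => by
    simpa [spinor_inner, spinor_fst, spinor_snd] using hφ _ (hχ.fst_mem_edgeDomain A)
  have h2 : φ.snd = 0 := eq_zero_of_inner_toL2 fun χ hχ => by
    simpa [spinor_inner, spinor_fst, spinor_snd] using hφ _ (hχ.snd_mem_edgeDomain A)
  exact spinor_ext h1 h2

/-! ### Regularity of the adjoint domain -/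

theorem isWeakDeriv_iff_inner {f g : L2} :
    IsWeakDeriv f g ↔ ∀ χ (hχ : IsTest χ), inner ℂ hχ.deriv.toL2 f = -inner ℂ hχ.toL2 g := by
  refine forall₂_congr fun χ hχ => ?_
  rw [hχ.deriv.inner_toL2, hχ.inner_toL2]

theorem exists_isWeakDeriv_of_inner {f g F : L2}
    (h : ∀ χ (hχ : IsTest χ), inner ℂ hχ.deriv.deriv.toL2 f
      = inner ℂ hχ.deriv.toL2 g + inner ℂ hχ.toL2 F) :
    ∃ f', IsWeakDeriv f f' := by
  refine exists_isWeakDeriv_of_second_order (g := g) (F := F) fun χ hχ => ?_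
  rw [← hχ.deriv.deriv.inner_toL2, h χ hχ, hχ.deriv.inner_toL2, hχ.inner_toL2]

theorem isWeakDeriv_of_inner {f f' g g' F : L2}
    (h : ∀ χ (hχ : IsTest χ), inner ℂ hχ.deriv.deriv.toL2 f
      = inner ℂ hχ.deriv.toL2 g + inner ℂ hχ.toL2 F)
    (hf : IsWeakDeriv f f') (hg : IsWeakDeriv g g') : IsWeakDeriv f' (F - g') := by
  rw [isWeakDeriv_iff_inner] at hf hg ⊢
  intro χ hχ
  have e1 := hf _ hχ.deriv
  have e2 := hg _ hχ
  have e3 := h _ hχ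
  rw [inner_sub_right]
  linear_combination e1 - e3 - e2

/-- Testing with spinors that have one component zero gives φ₁'' = -(φ₂/ε)' + F₁ and φ₂'' = -(φ₁/ε)'
+ F₂ as distributions, with F₁, F₂ in L². Interior regularity first yields φ₁' and φ₂' in L²; the
equations then put the second derivatives there too. -/
theorem edge_regularity {m ε k : ℝ} (hε : ε ≠ 0) {A : Matrix (Fin 2) (Fin 4) ℂ} {φ η : Spinor}
    (h : ∀ ψ ∈ edgeDomain A, inner ℂ η ψ = inner ℂ φ (edgeOp m ε k ψ)) :
    φ.fst ∈ H2 ∧ φ.snd ∈ H2 ∧ edgeOp m ε k φ = η := by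
  have hεc : (ε : ℂ) ≠ 0 := Complex.ofReal_ne_zero.2 hε
  set M : ℂ := ((m - ε * k ^ 2 : ℝ) : ℂ) with hM
  have hM' : ((-m + ε * k ^ 2 : ℝ) : ℂ) = -M := by rw [hM]; push_cast; ring
  have hMc : conj M = M := Complex.conj_ofReal _
  set F₁ : L2 := (ε : ℂ)⁻¹ • (η.fst - M • φ.fst + (k : ℂ) • φ.snd) with hF₁
  set F₂ : L2 := (ε : ℂ)⁻¹ • (-η.snd - (k : ℂ) • φ.fst - M • φ.snd) with hF₂
  have t1 : ∀ χ (hχ : IsTest χ), inner ℂ hχ.deriv.deriv.toL2 φ.fst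
      = inner ℂ hχ.deriv.toL2 ((ε : ℂ)⁻¹ • φ.snd) + inner ℂ hχ.toL2 F₁ := by
    intro χ hχ
    have e := congrArg conj (h _ (hχ.fst_mem_edgeDomain A))
    simp only [edgeOp, edgeFst, edgeSnd, spinor_inner, spinor_fst, spinor_snd, weakDeriv_zero,
      weakDeriv_eq hχ.weakDeriv_toL2, weakDeriv_eq hχ.deriv.weakDeriv_toL2, inner_zero_right,
      smul_zero, add_zero, sub_zero, inner_add_right, inner_sub_right, inner_smul_right, map_add,
      map_sub, map_mul, map_neg, inner_conj_symm, Complex.conj_ofReal, ← hM, hMc] at e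
    simp only [hF₁, inner_smul_right, inner_add_right, inner_sub_right]
    field_simp
    linear_combination -e
  have t2 : ∀ χ (hχ : IsTest χ), inner ℂ hχ.deriv.deriv.toL2 φ.snd
      = inner ℂ hχ.deriv.toL2 ((ε : ℂ)⁻¹ • φ.fst) + inner ℂ hχ.toL2 F₂ := by
    intro χ hχ
    have e := congrArg conj (h _ (hχ.snd_mem_edgeDomain A))
    simp only [edgeOp, edgeFst, edgeSnd, spinor_inner, spinor_fst, spinor_snd, weakDeriv_zero,
      weakDeriv_eq hχ.weakDeriv_toL2, weakDeriv_eq hχ.deriv.weakDeriv_toL2, inner_zero_right,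
      smul_zero, add_zero, zero_add, sub_zero, inner_add_right, inner_sub_right, inner_smul_right,
      map_add, map_sub, map_mul, map_neg, inner_conj_symm, Complex.conj_ofReal, hM', hMc] at e
    simp only [hF₂, inner_smul_right, inner_sub_right, inner_neg_right]
    field_simp
    linear_combination e
  obtain ⟨p, hp⟩ := exists_isWeakDeriv_of_inner t1
  obtain ⟨q, hq⟩ := exists_isWeakDeriv_of_inner t2
  have hp' := isWeakDeriv_of_inner t1 hp (hq.smul _)
  have hq' := isWeakDeriv_of_inner t2 hq (hp.smul _)
  refine ⟨⟨_, _, hp, hp'⟩, ⟨_, _, hq, hq'⟩, ?_⟩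
  have e1 : edgeFst m ε k φ = η.fst := by
    simp only [edgeFst, weakDeriv_eq hp,
    weakDeriv_eq hp', weakDeriv_eq hq, ← hM, hF₁, smul_sub,
      smul_add, smul_inv_smul₀ hεc, neg_smul]
    abel
  have e2 : edgeSnd m ε k φ = η.snd := by
    simp only [edgeSnd, weakDeriv_eq hp, weakDeriv_eq hq, weakDeriv_eq hq', hM', hF₂, smul_sub,
      smul_neg, smul_inv_smul₀ hεc, neg_smul]
    abel
  exact spinor_ext e1 e2

/-! ### Self-adjointness as a condition on boundary vectors -/

/-- `H♯(k)` with boundary condition `A` is self-adjoint iff `ker A` is a Lagrangian subspace for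
the boundary form. -/
theorem isSelfAdjoint_iff {m ε k : ℝ} (hε : ε ≠ 0) (A : Matrix (Fin 2) (Fin 4) ℂ) :
    IsSelfAdjoint (edgeHamiltonian m ε k A) ↔
      ∀ Φ, A.mulVec Φ = 0 ↔ ∀ Ψ, A.mulVec Ψ = 0 → boundaryForm ε Φ Ψ = 0 := by
  set T := edgeHamiltonian m ε k A with hT
  have hd : Dense (T.domain : Set Spinor) := dense_edgeDomain A
  rw [LinearPMap.isSelfAdjoint_def]
  constructor
  · intro hsa Φ
    have sym : ∀ φ ∈ edgeDomain A, ∀ ψ ∈ edgeDomain A,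
        inner ℂ (edgeOp m ε k φ) ψ = inner ℂ φ (edgeOp m ε k ψ) := by
      intro φ hφ ψ hψ
      have h := LinearPMap.adjoint_isFormalAdjoint hd
      rw [hsa] at h
      exact h ⟨φ, hφ⟩ ⟨ψ, hψ⟩
    constructor
    · intro hΦ Ψ hΨ
      obtain ⟨φ, hφ₁, hφ₂, hφ⟩ := exists_spinor_hasBoundaryVector Φ
      obtain ⟨ψ, hψ₁, hψ₂, hψ⟩ := exists_spinor_hasBoundaryVector Ψ
      rw [← inner_edgeOp_sub m ε k hφ₁ hφ₂ hψ₁ hψ₂ hφ hψ,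
        sym φ ⟨hφ₁, hφ₂, Φ, hφ, hΦ⟩ ψ ⟨hψ₁, hψ₂, Ψ, hψ, hΨ⟩, sub_self]
    · intro hΦ
      obtain ⟨φ, hφ₁, hφ₂, hφ⟩ := exists_spinor_hasBoundaryVector Φ
      -- Green's formula has no boundary term against the domain, so φ belongs to the adjoint
      -- domain, which is the domain itself; uniqueness of boundary vectors then gives A Φ = 0.
      have hmem : φ ∈ T.adjoint.domain := by
        refine LinearPMap.mem_adjoint_domain_of_exists φ ⟨edgeOp m ε k φ, ?_⟩
        rintro ⟨ψ, hψ₁, hψ₂, Ψ, hψ, hΨ⟩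
        have := inner_edgeOp_sub m ε k hφ₁ hφ₂ hψ₁ hψ₂ hφ hψ
        rw [hΦ Ψ hΨ, sub_eq_zero] at this
        exact this.symm
      rw [hsa] at hmem
      obtain ⟨-, -, Φ', hΦ', hA⟩ := hmem
      rwa [hφ.unique hΦ']
  · intro hlag
    refine le_antisymm ?_ (LinearPMap.IsFormalAdjoint.le_adjoint hd ?_)
    · have key : ∀ φ : T.adjoint.domain, (φ : Spinor) ∈ edgeDomain A ∧
          T.adjoint φ = edgeOp m ε k φ := by
        intro φ
        have hadj : ∀ ψ ∈ edgeDomain A,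
            inner ℂ (T.adjoint φ) ψ = inner ℂ (φ : Spinor) (edgeOp m ε k ψ) := fun ψ hψ =>
          LinearPMap.adjoint_isFormalAdjoint hd φ ⟨ψ, hψ⟩
        obtain ⟨h1, h2, he⟩ := edge_regularity hε hadj
        obtain ⟨Φ, hΦ⟩ := exists_hasBoundaryVector h1 h2
        refine ⟨⟨h1, h2, Φ, hΦ, (hlag Φ).2 fun Ψ hΨ => ?_⟩, he.symm⟩
        obtain ⟨ψ, hψ₁, hψ₂, hψ⟩ := exists_spinor_hasBoundaryVector Ψ
        rw [← inner_edgeOp_sub m ε k h1 h2 hψ₁ hψ₂ hΦ hψ, he,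
          hadj ψ ⟨hψ₁, hψ₂, Ψ, hψ, hΨ⟩, sub_self]
      refine ⟨fun φ hφ => (key ⟨φ, hφ⟩).1, ?_⟩
      intro φ ψ hφψ
      rw [(key φ).2, hφψ]
      rfl
    · rintro ⟨φ, hφ₁, hφ₂, Φ, hφ, hΦ⟩ ⟨ψ, hψ₁, hψ₂, Ψ, hψ, hΨ⟩
      have := inner_edgeOp_sub m ε k hφ₁ hφ₂ hψ₁ hψ₂ hφ hψ
      rw [(hlag Φ).1 hΦ Ψ hΨ, sub_eq_zero] at this
      exact this.symm

open scoped Matrix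

/-! ### Lagrangian kernels -/

/-- The matrix of the boundary form. -/
noncomputable def formMatrix (ε : ℝ) : Matrix (Fin 4) (Fin 4) ℂ :=
  !![0, -1, -(ε : ℂ), 0; 1, 0, 0, (ε : ℂ); (ε : ℂ), 0, 0, 0; 0, -(ε : ℂ), 0, 0]

/-- `ε` times the inverse of the matrix of the boundary form. -/
noncomputable def dualMatrix (ε : ℝ) : Matrix (Fin 4) (Fin 4) ℂ :=
  !![0, 0, 1, 0; 0, 0, 0, -1; -1, 0, 0, (ε : ℂ)⁻¹; 0, 1, -(ε : ℂ)⁻¹, 0]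

theorem boundaryForm_eq (ε : ℝ) (Φ Ψ : Fin 4 → ℂ) :
    boundaryForm ε Φ Ψ = star Φ ⬝ᵥ formMatrix ε *ᵥ Ψ := by
  simp [boundaryForm, formMatrix, dotProduct, Matrix.mulVec, Fin.sum_univ_four]
  ring

theorem formMatrix_conjTranspose (ε : ℝ) : (formMatrix ε)ᴴ = -formMatrix ε := by
  ext i j
  fin_cases i <;> fin_cases j <;> simp [formMatrix]

theorem dualMatrix_conjTranspose (ε : ℝ) : (dualMatrix ε)ᴴ = -dualMatrix ε := by
  ext i j
  fin_cases i <;> fin_cases j <;> simp [dualMatrix]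

theorem dualMatrix_mul_formMatrix {ε : ℝ} (hε : ε ≠ 0) :
    dualMatrix ε * formMatrix ε = (ε : ℂ) • (1 : Matrix (Fin 4) (Fin 4) ℂ) := by
  have hεc : (ε : ℂ) ≠ 0 := Complex.ofReal_ne_zero.2 hε
  ext i j
  fin_cases i <;> fin_cases j <;>
    simp [formMatrix, dualMatrix, Matrix.mul_apply, Fin.sum_univ_four, hεc]

theorem isUnit_det_dualMatrix {ε : ℝ} (hε : ε ≠ 0) : IsUnit (dualMatrix ε).det := by
  have hεc : (ε : ℂ) ≠ 0 := Complex.ofReal_ne_zero.2 hε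
  refine Matrix.isUnit_det_of_right_inverse (B := (ε : ℂ)⁻¹ • formMatrix ε) ?_
  rw [Matrix.mul_smul, dualMatrix_mul_formMatrix hε, inv_smul_smul₀ hεc]

/-- The annihilator of ker A is the range of the transpose, that is, the row space. -/
theorem exists_dotProduct_of_ker_le {m n : Type*} [Fintype m] [Fintype n] [DecidableEq m]
    (A : Matrix m n ℂ) (w : n → ℂ) (h : ∀ Ψ, A *ᵥ Ψ = 0 → w ⬝ᵥ Ψ = 0) :
    ∃ d : m → ℂ, w = d ᵥ* A := by
  classical
  let L : Module.Dual ℂ (n → ℂ) := dotProductBilin ℂ ℂ w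
  have hL : L ∈ (LinearMap.ker A.mulVecLin).dualAnnihilator := by
    rw [Submodule.mem_dualAnnihilator]
    intro Ψ hΨ
    exact h Ψ hΨ
  rw [← LinearMap.range_dualMap_eq_dualAnnihilator_ker] at hL
  obtain ⟨l, hl⟩ := hL
  refine ⟨fun i => l (fun j => if i = j then 1 else 0), dotProduct_eq _ _ fun Ψ => ?_⟩
  rw [← Matrix.dotProduct_mulVec]
  have e : w ⬝ᵥ Ψ = l (A *ᵥ Ψ) := (LinearMap.congr_fun hl Ψ).symm
  rw [e, LinearMap.pi_apply_eq_sum_univ]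
  simp [dotProduct, mul_comm]

/-- Identifies the orthogonal complement of ker A: Φ* times the form matrix must lie in the row
space of A, and the form matrix is inverted by `dualMatrix ε` up to the factor ε. -/
theorem boundaryForm_eq_zero_iff {ε : ℝ} (hε : ε ≠ 0) (A : Matrix (Fin 2) (Fin 4) ℂ)
    (Φ : Fin 4 → ℂ) :
    (∀ Ψ, A *ᵥ Ψ = 0 → boundaryForm ε Φ Ψ = 0) ↔ ∃ c, (dualMatrix ε * Aᴴ) *ᵥ c = Φ := by
  have hεc : (ε : ℂ) ≠ 0 := Complex.ofReal_ne_zero.2 hε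
  constructor
  · intro h
    obtain ⟨d, hd⟩ := exists_dotProduct_of_ker_le A (star Φ ᵥ* formMatrix ε) fun Ψ hΨ => by
      rw [← Matrix.dotProduct_mulVec, ← boundaryForm_eq, h Ψ hΨ]
    have e := congrArg star hd
    rw [Matrix.star_vecMul, Matrix.star_vecMul, star_star, formMatrix_conjTranspose] at e
    refine ⟨-(ε : ℂ)⁻¹ • star d, ?_⟩
    rw [Matrix.mulVec_smul, ← Matrix.mulVec_mulVec, ← e, Matrix.neg_mulVec, Matrix.mulVec_neg,
      Matrix.mulVec_mulVec, dualMatrix_mul_formMatrix hε, Matrix.smul_mulVec, Matrix.one_mulVec,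
      neg_smul, smul_neg, neg_neg, inv_smul_smul₀ hεc]
  · rintro ⟨c, rfl⟩ Ψ hΨ
    rw [boundaryForm_eq, Matrix.star_mulVec, Matrix.conjTranspose_mul, Matrix.conjTranspose_conjTranspose,
      dualMatrix_conjTranspose, ← Matrix.dotProduct_mulVec, Matrix.mulVec_mulVec, Matrix.mul_assoc,
      Matrix.neg_mul, dualMatrix_mul_formMatrix hε, ← Matrix.mulVec_mulVec, Matrix.neg_mulVec,
      Matrix.smul_mulVec, Matrix.one_mulVec, Matrix.mulVec_neg, Matrix.mulVec_smul, hΨ]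
    simp

-- The Lagrangian condition says ker A = range (J Aᴴ), with J the dual matrix. The dimensions are 4
-- - rank A and rank A, so rank A = 2; conversely A J Aᴴ = 0 is one inclusion, and equal dimensions
-- upgrade it to equality.
open scoped ComplexOrder in
theorem lagrangian_iff {ε : ℝ} (hε : ε ≠ 0) (A : Matrix (Fin 2) (Fin 4) ℂ) :
    (∀ Φ, A *ᵥ Φ = 0 ↔ ∀ Ψ, A *ᵥ Ψ = 0 → boundaryForm ε Φ Ψ = 0) ↔
      A.rank = 2 ∧ A * dualMatrix ε * Aᴴ = 0 := by
  have hdim : A.rank + Module.finrank ℂ (LinearMap.ker A.mulVecLin) = 4 := by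
    have := LinearMap.finrank_range_add_finrank_ker A.mulVecLin
    simpa [Matrix.rank] using this
  have hrange : Module.finrank ℂ (LinearMap.range (dualMatrix ε * Aᴴ).mulVecLin) = A.rank := by
    have : (dualMatrix ε * Aᴴ).rank = A.rank := by
      rw [Matrix.rank_mul_eq_right_of_isUnit_det _ _ (isUnit_det_dualMatrix hε),
        Matrix.rank_conjTranspose]
    exact this
  have hiff : (∀ Φ, A *ᵥ Φ = 0 ↔ ∀ Ψ, A *ᵥ Ψ = 0 → boundaryForm ε Φ Ψ = 0) ↔
      LinearMap.ker A.mulVecLin = LinearMap.range (dualMatrix ε * Aᴴ).mulVecLin := by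
    rw [SetLike.ext_iff]
    refine forall_congr' fun Φ => ?_
    rw [boundaryForm_eq_zero_iff hε]
    rfl
  rw [hiff]
  constructor
  · intro h
    refine ⟨by rw [h, hrange] at hdim; omega, ?_⟩
    rw [Matrix.mul_assoc]
    refine Matrix.ext_of_mulVec_single fun i => ?_
    rw [← Matrix.mulVec_mulVec, Matrix.zero_mulVec]
    have : (dualMatrix ε * Aᴴ) *ᵥ Pi.single i 1 ∈ LinearMap.ker A.mulVecLin := by
      rw [h]
      exact ⟨_, rfl⟩
    exact this
  · rintro ⟨hr, h0⟩
    refine (Submodule.eq_of_le_of_finrank_eq ?_ (by omega)).symm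
    rintro _ ⟨c, rfl⟩
    rw [LinearMap.mem_ker, Matrix.mulVecLin_apply, Matrix.mulVecLin_apply, Matrix.mulVec_mulVec,
      ← Matrix.mul_assoc, h0, Matrix.zero_mulVec]

theorem isSelfAdjoint_iff_rank {m ε k : ℝ} (hε : ε ≠ 0) (A : Matrix (Fin 2) (Fin 4) ℂ) :
    IsSelfAdjoint (edgeHamiltonian m ε k A) ↔ A.rank = 2 ∧ A * dualMatrix ε * Aᴴ = 0 :=
  (isSelfAdjoint_iff hε A).trans (lagrangian_iff hε A)

/-! ### Rank and equivalence -/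

theorem rank_eq_two_iff (A : Matrix (Fin 2) (Fin 4) ℂ) : A.rank = 2 ↔ ∀ x, x ᵥ* A = 0 → x = 0 := by
  have h := LinearMap.finrank_range_add_finrank_ker Aᵀ.mulVecLin
  have hr : Module.finrank ℂ (LinearMap.range Aᵀ.mulVecLin) = A.rank := A.rank_transpose
  rw [hr, Module.finrank_fin_fun] at h
  have : A.rank = 2 ↔ LinearMap.ker Aᵀ.mulVecLin = ⊥ := by
    rw [← Submodule.finrank_eq_zero]
    omega
  rw [this, LinearMap.ker_eq_bot']
  simp

theorem rank_gl_mul (G : GL (Fin 2) ℂ) (A : Matrix (Fin 2) (Fin 4) ℂ) :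
    ((G : Matrix (Fin 2) (Fin 2) ℂ) * A).rank = A.rank :=
  Matrix.rank_mul_eq_right_of_isUnit_det _ _ ((Matrix.isUnit_iff_isUnit_det _).1 G.isUnit)

theorem gl_inv_mul_cancel (G : GL (Fin 2) ℂ) (A : Matrix (Fin 2) (Fin 4) ℂ) :
    ((G⁻¹ : GL (Fin 2) ℂ) : Matrix (Fin 2) (Fin 2) ℂ) * ((G : Matrix (Fin 2) (Fin 2) ℂ) * A) = A := by
  rw [← Matrix.mul_assoc, ← Units.val_mul, inv_mul_cancel, Units.val_one, Matrix.one_mul]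

theorem isotropic_mul {ε : ℝ} {A : Matrix (Fin 2) (Fin 4) ℂ} (G : Matrix (Fin 2) (Fin 2) ℂ)
    (h : A * dualMatrix ε * Aᴴ = 0) : (G * A) * dualMatrix ε * (G * A)ᴴ = 0 := by
  have e : (G * A) * dualMatrix ε * (G * A)ᴴ = G * (A * dualMatrix ε * Aᴴ) * Gᴴ := by
    simp only [Matrix.conjTranspose_mul, Matrix.mul_assoc]
  rw [e, h, Matrix.mul_zero, Matrix.zero_mul]

theorem Equivalent.symm {A A' : Matrix (Fin 2) (Fin 4) ℂ} (h : Equivalent A A') :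
    Equivalent A' A := by
  obtain ⟨G, rfl⟩ := h
  exact ⟨G⁻¹, (gl_inv_mul_cancel G A).symm⟩

theorem Equivalent.trans {A A' A'' : Matrix (Fin 2) (Fin 4) ℂ} (h : Equivalent A A')
    (h' : Equivalent A' A'') : Equivalent A A'' := by
  obtain ⟨G, rfl⟩ := h
  obtain ⟨G', rfl⟩ := h'
  exact ⟨G' * G, by rw [Units.val_mul, Matrix.mul_assoc]⟩

theorem Equivalent.isotropic {ε : ℝ} {A A' : Matrix (Fin 2) (Fin 4) ℂ} (h : Equivalent A A')
    (hA : A * dualMatrix ε * Aᴴ = 0) : A' * dualMatrix ε * A'ᴴ = 0 := by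
  obtain ⟨G, rfl⟩ := h
  exact isotropic_mul _ hA

theorem Equivalent.rank_eq {A A' : Matrix (Fin 2) (Fin 4) ℂ} (h : Equivalent A A') :
    A'.rank = A.rank := by
  obtain ⟨G, rfl⟩ := h
  exact rank_gl_mul G A

theorem mul_pencil (G : Matrix (Fin 2) (Fin 2) ℂ) (A₀ A₁ : Matrix (Fin 2) (Fin 4) ℂ) (k : ℝ) :
    pencil (G * A₀) (G * A₁) k = G * pencil A₀ A₁ k := by
  rw [pencil, pencil, Matrix.mul_add, Matrix.mul_smul]

/-! ### Isotropic pencils -/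

/-- The last two columns of a matrix vanish. -/
def LeftSupported (A : Matrix (Fin 2) (Fin 4) ℂ) : Prop := ∀ i, A i 2 = 0 ∧ A i 3 = 0

theorem mul_apply_two {n : Type*} (G : Matrix (Fin 2) (Fin 2) ℂ) (A : Matrix (Fin 2) n ℂ)
    (i : Fin 2) (j : n) : (G * A) i j = G i 0 * A 0 j + G i 1 * A 1 j := by
  rw [Matrix.mul_apply, Fin.sum_univ_two]

theorem LeftSupported.mul {A : Matrix (Fin 2) (Fin 4) ℂ} (h : LeftSupported A)
    (G : Matrix (Fin 2) (Fin 2) ℂ) : LeftSupported (G * A) := by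
  intro i
  simp [mul_apply_two, (h 0).1, (h 0).2, (h 1).1, (h 1).2]

/-- The sesquilinear form of `dualMatrix ε`. -/
noncomputable def skewForm (ε : ℝ) (a b : Fin 4 → ℂ) : ℂ :=
  a 0 * conj (b 2) - a 1 * conj (b 3) - a 2 * conj (b 0) + a 3 * conj (b 1)
    + (ε : ℂ)⁻¹ * (a 2 * conj (b 3) - a 3 * conj (b 2))

theorem mul_dualMatrix_mul_apply (ε : ℝ) (A B : Matrix (Fin 2) (Fin 4) ℂ) (i j : Fin 2) :
    (A * dualMatrix ε * Bᴴ) i j = skewForm ε (A i) (B j) := by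
  simp [Matrix.mul_apply, Fin.sum_univ_four, dualMatrix, skewForm]
  ring

/-- The upper left 2 × 2 block of `dualMatrix ε` is zero. This removes the k² term from the isotropy
condition of a pencil. -/
theorem LeftSupported.isotropic {A : Matrix (Fin 2) (Fin 4) ℂ} (h : LeftSupported A) (ε : ℝ) :
    A * dualMatrix ε * Aᴴ = 0 := by
  ext i j
  simp [mul_dualMatrix_mul_apply, skewForm, (h i).1, (h i).2, (h j).1, (h j).2]

/-- The coefficient conditions under which `A₀ + i k A₁` is isotropic for all `k`. -/
structure IsotropicPair (ε : ℝ) (A₀ A₁ : Matrix (Fin 2) (Fin 4) ℂ) : Prop where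
  left : LeftSupported A₁
  const : A₀ * dualMatrix ε * A₀ᴴ = 0
  linear : A₁ * dualMatrix ε * A₀ᴴ = A₀ * dualMatrix ε * A₁ᴴ

theorem pencil_isotropic_eq {ε : ℝ} {A₀ A₁ : Matrix (Fin 2) (Fin 4) ℂ} (h : LeftSupported A₁)
    (k : ℝ) : pencil A₀ A₁ k * dualMatrix ε * (pencil A₀ A₁ k)ᴴ = A₀ * dualMatrix ε * A₀ᴴ
      + (Complex.I * (k : ℂ)) • (A₁ * dualMatrix ε * A₀ᴴ - A₀ * dualMatrix ε * A₁ᴴ) := by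
  have h2 := h.isotropic ε
  have hs : star (Complex.I * (k : ℂ)) = -(Complex.I * k) := by simp
  rw [pencil, Matrix.conjTranspose_add, Matrix.conjTranspose_smul, hs, Matrix.add_mul, Matrix.add_mul,
    Matrix.mul_add, Matrix.mul_add, Matrix.smul_mul, Matrix.smul_mul, Matrix.smul_mul,
    Matrix.mul_smul, Matrix.mul_smul, h2]
  module

theorem IsotropicPair.isotropic {ε : ℝ} {A₀ A₁ : Matrix (Fin 2) (Fin 4) ℂ}
    (h : IsotropicPair ε A₀ A₁) (k : ℝ) :
    pencil A₀ A₁ k * dualMatrix ε * (pencil A₀ A₁ k)ᴴ = 0 := by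
  rw [pencil_isotropic_eq h.left, h.const, h.linear]
  simp

/-- An affine function of k that vanishes at two distinct points has both coefficients zero. -/
theorem IsotropicPair.of_ae {ε : ℝ} {A₀ A₁ : Matrix (Fin 2) (Fin 4) ℂ} (hl : LeftSupported A₁)
    (h : ∀ᵐ k : ℝ, pencil A₀ A₁ k * dualMatrix ε * (pencil A₀ A₁ k)ᴴ = 0) :
    IsotropicPair ε A₀ A₁ := by
  simp only [pencil_isotropic_eq hl] at h
  obtain ⟨k, hk⟩ := h.exists
  obtain ⟨l, hlk, hl0⟩ := (((Set.finite_singleton k).countable.ae_notMem volume).and h).exists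
  have hne : (l : ℂ) - k ≠ 0 := by
    rw [sub_ne_zero]
    exact fun h => hlk (by simpa using h)
  set D := A₁ * dualMatrix ε * A₀ᴴ - A₀ * dualMatrix ε * A₁ᴴ
  have hD : D = 0 := by
    have e : (Complex.I * ((l : ℂ) - k)) • D = 0 := by
      rw [← sub_self (0 : Matrix (Fin 2) (Fin 2) ℂ)]
      nth_rewrite 1 [← hl0]
      nth_rewrite 1 [← hk]
      module
    exact (smul_eq_zero.1 e).resolve_left (mul_ne_zero Complex.I_ne_zero hne)
  rw [hD, smul_zero, add_zero] at hk
  exact ⟨hl, hk, sub_eq_zero.1 hD⟩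

theorem IsotropicPair.mul {ε : ℝ} {A₀ A₁ : Matrix (Fin 2) (Fin 4) ℂ} (h : IsotropicPair ε A₀ A₁)
    (G : Matrix (Fin 2) (Fin 2) ℂ) : IsotropicPair ε (G * A₀) (G * A₁) := by
  refine ⟨h.left.mul G, isotropic_mul G h.const, ?_⟩
  have e : ∀ A B : Matrix (Fin 2) (Fin 4) ℂ,
      (G * A) * dualMatrix ε * (G * B)ᴴ = G * (A * dualMatrix ε * Bᴴ) * Gᴴ := by
    intro A B
    simp only [Matrix.conjTranspose_mul, Matrix.mul_assoc]
  rw [e, e, h.linear]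

theorem IsotropicPair.const_apply {ε : ℝ} {A₀ A₁ : Matrix (Fin 2) (Fin 4) ℂ}
    (h : IsotropicPair ε A₀ A₁) (i j : Fin 2) : skewForm ε (A₀ i) (A₀ j) = 0 := by
  rw [← mul_dualMatrix_mul_apply, h.const, Matrix.zero_apply]

theorem IsotropicPair.linear_apply {ε : ℝ} {A₀ A₁ : Matrix (Fin 2) (Fin 4) ℂ}
    (h : IsotropicPair ε A₀ A₁) (i j : Fin 2) :
    skewForm ε (A₁ i) (A₀ j) = skewForm ε (A₀ i) (A₁ j) := by
  rw [← mul_dualMatrix_mul_apply, h.linear, mul_dualMatrix_mul_apply]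

/-- If `A₀` has full rank, then so has `A₀ + i k A₁` for almost every `k`. -/
theorem ae_rank_pencil {A₀ : Matrix (Fin 2) (Fin 4) ℂ} (A₁ : Matrix (Fin 2) (Fin 4) ℂ)
    (h : A₀.rank = 2) : ∀ᵐ k : ℝ, (pencil A₀ A₁ k).rank = 2 := by
  have hsurj : Function.Surjective A₀.mulVec := by
    have : LinearMap.range A₀.mulVecLin = ⊤ := by
      refine Submodule.eq_top_of_finrank_eq ?_
      rw [Module.finrank_fin_fun]
      exact h
    exact LinearMap.range_eq_top.1 this
  obtain ⟨R, hR⟩ := Matrix.mulVec_surjective_iff_exists_right_inverse.1 hsurj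
  set N := A₁ * R
  -- With R a right inverse of A₀ and N = A₁ R, this is det (1 + i X N). Its constant term is 1, so
  -- it has finitely many zeros, and off them A(k) R is invertible.
  let p : Polynomial ℂ := 1 + Polynomial.C (Complex.I * N.trace) * Polynomial.X
    - Polynomial.C N.det * Polynomial.X ^ 2
  have hp : p ≠ 0 := by
    intro h0
    have := congrArg (Polynomial.eval 0) h0
    simp [p] at this
  have hdet : ∀ k : ℝ, (pencil A₀ A₁ k * R).det = p.eval (k : ℂ) := by
    intro k
    rw [pencil, Matrix.add_mul, hR, Matrix.smul_mul, Matrix.det_fin_two]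
    simp only [p, Matrix.add_apply, Matrix.smul_apply, smul_eq_mul, Matrix.one_apply_eq,
      Polynomial.eval_add, Polynomial.eval_sub, Polynomial.eval_mul, Polynomial.eval_one,
      Polynomial.eval_C, Polynomial.eval_X, Polynomial.eval_pow, Matrix.trace_fin_two,
      Matrix.det_fin_two, N]
    rw [Matrix.one_apply_ne (by decide), Matrix.one_apply_ne (by decide)]
    linear_combination ((A₁ * R) 0 0 * (A₁ * R) 1 1 - (A₁ * R) 0 1 * (A₁ * R) 1 0) * (k : ℂ) ^ 2
      * Complex.I_sq
  have hfin : {k : ℝ | p.eval (k : ℂ) = 0}.Finite := by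
    refine ((p.roots.toFinset : Set ℂ).toFinite.preimage
      (Complex.ofReal_injective.injOn (s := Complex.ofReal ⁻¹' p.roots.toFinset))).subset
      fun k hk => ?_
    simpa [hp] using hk
  filter_upwards [hfin.countable.ae_notMem volume] with k hk
  rw [rank_eq_two_iff]
  intro x hx
  refine Matrix.eq_zero_of_vecMul_eq_zero (M := pencil A₀ A₁ k * R) ?_ ?_
  · rw [hdet]
    exact hk
  · rw [← Matrix.vecMul_vecMul, hx, Matrix.zero_vecMul]

/-! ### Members of the seven classes are isotropic -/

/-- In the classes 𝔅 and ℭ the matrix A₀ is the column (1, μ) times a row v, so its isotropy reduces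
to one scalar equation for v. -/
theorem skewForm_vecMulVec (ε : ℝ) (w : Fin 2 → ℂ) (v : Fin 4 → ℂ) (i j : Fin 2) :
    skewForm ε (Matrix.vecMulVec w v i) (Matrix.vecMulVec w v j)
      = w i * conj (w j) * skewForm ε v v := by
  simp only [skewForm, Matrix.vecMulVec_apply, map_mul]
  ring

theorem InClass.isotropicPair {ε : ℝ} (hε : ε ≠ 0) {c : BCClass}
    {A₀ A₁ : Matrix (Fin 2) (Fin 4) ℂ} (h : InClass ε c A₀ A₁) : IsotropicPair ε A₀ A₁ := by
  have hεc : (ε : ℂ) ≠ 0 := Complex.ofReal_ne_zero.2 hε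
  cases c with
  | A12 =>
    obtain ⟨b₁₁, b₁₂, b₂₁, b₂₂, rfl, rfl⟩ := h
    refine ⟨fun i => ?_, ?_, ?_⟩
    · fin_cases i <;> simp
    all_goals
      ext i j
      rw [mul_dualMatrix_mul_apply]
      try rw [mul_dualMatrix_mul_apply]
      fin_cases i <;> fin_cases j <;> simp [skewForm]
  | A14 =>
    obtain ⟨α, β, b₁₁, b₂₁, rfl, rfl⟩ := h
    refine ⟨fun i => ?_, ?_, ?_⟩
    · fin_cases i <;> simp
    all_goals
      ext i j
      rw [mul_dualMatrix_mul_apply]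
      try rw [mul_dualMatrix_mul_apply]
      fin_cases i <;> fin_cases j <;> simp [skewForm]
  | A23 =>
    obtain ⟨α, β, b₁₂, b₂₂, rfl, rfl⟩ := h
    refine ⟨fun i => ?_, ?_, ?_⟩
    · fin_cases i <;> simp
    all_goals
      ext i j
      rw [mul_dualMatrix_mul_apply]
      try rw [mul_dualMatrix_mul_apply]
      fin_cases i <;> fin_cases j <;> simp [skewForm]
  | A24 =>
    obtain ⟨α, β, a₁₁, a₂₁, b₁₁, b₂₁, b₂₂, ha, rfl, hb, rfl, rfl⟩ := h
    have ha' : conj a₁₁ ≠ 0 := by simpa using ha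
    have hb' := congrArg conj hb
    simp only [map_sub, map_mul, map_inv₀, Complex.conj_I, Complex.conj_ofReal] at hb'
    refine ⟨fun i => ?_, ?_, ?_⟩
    · fin_cases i <;> simp
    all_goals
      ext i j
      rw [mul_dualMatrix_mul_apply]
      try rw [mul_dualMatrix_mul_apply]
      fin_cases i <;> fin_cases j <;> simp [skewForm, ha]
    · field_simp
      ring
    · ring
    · linear_combination -hb - hb'
  | A34 =>
    obtain ⟨α₁, α₂, β₁, β₂, a₁₂, b₁₂, rfl, rfl⟩ := h
    refine ⟨fun i => ?_, ?_, ?_⟩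
    · fin_cases i <;> simp
    all_goals
      ext i j
      rw [mul_dualMatrix_mul_apply]
      try rw [mul_dualMatrix_mul_apply]
      fin_cases i <;> fin_cases j <;> simp [skewForm]
    ring
  | B =>
    obtain ⟨α, a₁, a₂, μ, hα, rfl, rfl⟩ := h
    -- The defining constraint of 𝔅 multiplied by 2i, with Im and Re written through conjugates.
    have hc : (α : ℂ) * (α * (μ - conj μ)
        + Complex.I * ε * (a₁ + a₂ * μ + conj (a₁ + a₂ * μ))) = 0 := by
      have e1 : μ - conj μ = 2 * Complex.I * (μ.im : ℂ) := by
        rw [Complex.sub_conj]; push_cast; ring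
      have e2 : a₁ + a₂ * μ + conj (a₁ + a₂ * μ) = 2 * ((a₁ + a₂ * μ).re : ℂ) := by
        rw [Complex.add_conj]; push_cast; ring
      rw [e1, e2]
      have := congrArg (fun x : ℝ => (x : ℂ)) hα
      push_cast at this
      linear_combination 2 * Complex.I * this
    simp only [map_add, map_mul] at hc
    have hn : ((‖μ‖ ^ 2 : ℝ) : ℂ) = μ * conj μ := by
      rw [Complex.mul_conj']; push_cast; ring
    rw [hn]
    refine ⟨fun i => ?_, ?_, ?_⟩
    · fin_cases i <;> simp
    · ext i j
      rw [mul_dualMatrix_mul_apply]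
      rw [show !![a₁, a₂, Complex.I * α, -(Complex.I * conj μ * α);
          μ * a₁, μ * a₂, Complex.I * μ * α, -(Complex.I * (μ * conj μ) * α)]
          = Matrix.vecMulVec ![1, μ] ![a₁, a₂, Complex.I * α, -(Complex.I * conj μ * α)] by
        ext i j
        fin_cases i <;> fin_cases j <;> simp [Matrix.vecMulVec_apply] <;> ring,
        skewForm_vecMulVec]
      have h0 : skewForm ε ![a₁, a₂, Complex.I * α, -(Complex.I * conj μ * α)]
          ![a₁, a₂, Complex.I * α, -(Complex.I * conj μ * α)] = 0 := by
        simp [skewForm]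
        linear_combination (-(ε : ℂ)⁻¹) * hc
          + Complex.I * α * (a₁ + a₂ * μ + (conj a₁ + conj a₂ * conj μ)) * (mul_inv_cancel₀ hεc)
          + (ε : ℂ)⁻¹ * α ^ 2 * (μ - conj μ) * Complex.I_sq
      rw [h0, mul_zero, Matrix.zero_apply]
    · ext i j
      rw [mul_dualMatrix_mul_apply, mul_dualMatrix_mul_apply]
      fin_cases i <;> fin_cases j <;> simp [skewForm]
      ring_nf
      simp
  | C =>
    obtain ⟨a₁, a₂, a₄, μ, -, -, h0, rfl, rfl⟩ := h
    have hc : a₂ * conj a₄ = a₄ * conj a₂ := by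
      have := Complex.conj_eq_iff_im.2 h0
      rw [map_mul, Complex.conj_conj] at this
      rw [← this]; ring
    refine ⟨fun i => ?_, ?_, ?_⟩
    · fin_cases i <;> simp
    · ext i j
      rw [mul_dualMatrix_mul_apply]
      rw [show !![a₁, a₂, 0, a₄; μ * a₁, μ * a₂, 0, μ * a₄]
          = Matrix.vecMulVec ![1, μ] ![a₁, a₂, 0, a₄] by
        ext i j
        fin_cases i <;> fin_cases j <;> simp [Matrix.vecMulVec_apply],
        skewForm_vecMulVec]
      have h0 : skewForm ε ![a₁, a₂, 0, a₄] ![a₁, a₂, 0, a₄] = 0 := by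
        simp [skewForm]
        linear_combination -hc
      rw [h0, mul_zero, Matrix.zero_apply]
    · ext i j
      rw [mul_dualMatrix_mul_apply, mul_dualMatrix_mul_apply]
      fin_cases i <;> fin_cases j <;> simp [skewForm]

/-! ### Normal forms of isotropic pairs -/

/-- A single `GL₂` factor brings the pair into one of the first five classes. -/
def HasNormalForm (ε : ℝ) (A₀ A₁ : Matrix (Fin 2) (Fin 4) ℂ) : Prop :=
  ∃ c, c ≠ BCClass.B ∧ c ≠ BCClass.C ∧ ∃ G : GL (Fin 2) ℂ,
    InClass ε c ((G : Matrix (Fin 2) (Fin 2) ℂ) * A₀) ((G : Matrix (Fin 2) (Fin 2) ℂ) * A₁)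

theorem HasNormalForm.of_gl_mul {ε : ℝ} {A₀ A₁ : Matrix (Fin 2) (Fin 4) ℂ} (g : GL (Fin 2) ℂ)
    (h : HasNormalForm ε ((g : Matrix (Fin 2) (Fin 2) ℂ) * A₀) ((g : Matrix (Fin 2) (Fin 2) ℂ) * A₁)) :
    HasNormalForm ε A₀ A₁ := by
  obtain ⟨c, h1, h2, G, h⟩ := h
  refine ⟨c, h1, h2, G * g, ?_⟩
  rw [Units.val_mul, Matrix.mul_assoc, Matrix.mul_assoc]
  exact h

theorem HasNormalForm.of_inClass {ε : ℝ} {A₀ A₁ : Matrix (Fin 2) (Fin 4) ℂ} {c : BCClass}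
    (h1 : c ≠ BCClass.B) (h2 : c ≠ BCClass.C) (h : InClass ε c A₀ A₁) : HasNormalForm ε A₀ A₁ :=
  ⟨c, h1, h2, 1, by simpa using h⟩

/-- The matrix with given entries as an element of `GL₂(ℂ)`. -/
noncomputable def glOf (a b c d : ℂ) (h : a * d - b * c ≠ 0) : GL (Fin 2) ℂ :=
  Matrix.GeneralLinearGroup.mkOfDetNeZero !![a, b; c, d] (by rwa [Matrix.det_fin_two_of])

theorem glOf_mul_zero {a b c d : ℂ} (h : a * d - b * c ≠ 0) {n : Type*} (A : Matrix (Fin 2) n ℂ)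
    (j : n) : ((glOf a b c d h : Matrix (Fin 2) (Fin 2) ℂ) * A) 0 j = a * A 0 j + b * A 1 j := by
  rw [mul_apply_two]
  rfl

theorem glOf_mul_one {a b c d : ℂ} (h : a * d - b * c ≠ 0) {n : Type*} (A : Matrix (Fin 2) n ℂ)
    (j : n) : ((glOf a b c d h : Matrix (Fin 2) (Fin 2) ℂ) * A) 1 j = c * A 0 j + d * A 1 j := by
  rw [mul_apply_two]
  rfl

/-- Every nonzero vector is the first row of an invertible matrix. -/
theorem exists_gl_mul_zero_apply {x : Fin 2 → ℂ} (hx : x ≠ 0) :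
    ∃ g : GL (Fin 2) ℂ, ∀ A : Matrix (Fin 2) (Fin 4) ℂ,
      ∀ j, ((g : Matrix (Fin 2) (Fin 2) ℂ) * A) 0 j = (x ᵥ* A) j := by
  -- The second row is (-conj x₁, conj x₀), so that the determinant is |x₀|² + |x₁|².
  have hdet : x 0 * conj (x 0) - x 1 * (-conj (x 1)) ≠ 0 := by
    rw [mul_neg, sub_neg_eq_add, Complex.mul_conj, Complex.mul_conj, ← Complex.ofReal_add,
      Complex.ofReal_ne_zero]
    intro h0
    have p0 := Complex.normSq_nonneg (x 0)
    have p1 := Complex.normSq_nonneg (x 1)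
    have z0 : x 0 = 0 := Complex.normSq_eq_zero.1 (by linarith)
    have z1 : x 1 = 0 := Complex.normSq_eq_zero.1 (by linarith)
    apply hx
    funext i
    fin_cases i
    · exact z0
    · exact z1
  refine ⟨glOf _ _ _ _ hdet, fun A j => ?_⟩
  rw [glOf_mul_zero]
  simp [Matrix.vecMul, dotProduct, Fin.sum_univ_two]

theorem eq_ofReal_of_sub_conj {z : ℂ} (h : z - conj z = 0) : z = (z.re : ℂ) :=
  (Complex.conj_eq_iff_re.1 (sub_eq_zero.1 h).symm).symm

theorem eq_I_mul_of_add_conj {z : ℂ} (h : z + conj z = 0) : z = Complex.I * (z.im : ℂ) := by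
  have h1 := congrArg Complex.re h
  simp only [Complex.add_re, Complex.conj_re, Complex.zero_re] at h1
  apply Complex.ext
  · simp
    linarith
  · simp

theorem eta_two_four (A : Matrix (Fin 2) (Fin 4) ℂ) :
    A = !![A 0 0, A 0 1, A 0 2, A 0 3; A 1 0, A 1 1, A 1 2, A 1 3] := by
  ext i j
  fin_cases i <;> fin_cases j <;> rfl

section NormalForm

variable {ε : ℝ} {A₀ A₁ : Matrix (Fin 2) (Fin 4) ℂ}

/-- Once the pivots are normalised, the diagonal isotropy equations make the constant entries real
and the linear ones imaginary, while the off-diagonal equations tie the (1,0) entries to the (0,1)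
entries. The next three lemmas follow the same pattern. -/
theorem IsotropicPair.inClass_A34 (h : IsotropicPair ε A₀ A₁) (h02 : A₀ 0 2 = 1) (h03 : A₀ 0 3 = 0)
    (h12 : A₀ 1 2 = 0) (h13 : A₀ 1 3 = 1) : InClass ε .A34 A₀ A₁ := by
  have c00 := h.const_apply 0 0
  have c01 := h.const_apply 0 1
  have c11 := h.const_apply 1 1
  have l00 := h.linear_apply 0 0
  have l01 := h.linear_apply 0 1
  have l11 := h.linear_apply 1 1
  simp only [skewForm, h02, h03, h12, h13, (h.left 0).1, (h.left 0).2, (h.left 1).1, (h.left 1).2,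
    map_one, map_zero, mul_one, mul_zero, zero_mul, one_mul, sub_zero, zero_sub, add_zero, zero_add,
    sub_self] at c00 c01 c11 l00 l01 l11
  have e0 := eq_ofReal_of_sub_conj c00
  have e1 := eq_ofReal_of_sub_conj (z := A₀ 1 1) (by linear_combination -c11)
  have f0 := eq_I_mul_of_add_conj (z := A₁ 0 0) (by linear_combination l00)
  have f1 := eq_I_mul_of_add_conj (z := A₁ 1 1) (by linear_combination -l11)
  have g0 : A₀ 1 0 = (ε : ℂ)⁻¹ - conj (A₀ 0 1) := by
    have := congrArg conj c01
    simp only [map_add, map_sub, map_neg, map_inv₀, Complex.conj_ofReal, Complex.conj_conj,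
      map_zero] at this
    linear_combination -this
  have g1 : A₁ 1 0 = conj (A₁ 0 1) := by
    have := congrArg conj l01
    simp only [map_neg, Complex.conj_conj] at this
    linear_combination this
  refine ⟨(A₀ 0 0).re, (A₀ 1 1).re, (A₁ 0 0).im, (A₁ 1 1).im, A₀ 0 1, A₁ 0 1, ?_, ?_⟩
  · rw [← e0, ← e1, ← g0]
    nth_rewrite 1 [eta_two_four A₀]
    rw [h02, h03, h12, h13]
  · rw [← f0, ← f1, ← g1]
    nth_rewrite 1 [eta_two_four A₁]
    rw [(h.left 0).1, (h.left 0).2, (h.left 1).1, (h.left 1).2]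

theorem IsotropicPair.inClass_A14 (h : IsotropicPair ε A₀ A₁) (h00 : A₀ 0 0 = 1) (h01 : A₀ 0 1 = 0)
    (h02 : A₀ 0 2 = 0) (h03 : A₀ 0 3 = 0) (h10 : A₀ 1 0 = 0) (h12 : A₀ 1 2 = 0)
    (h13 : A₀ 1 3 = 1) : InClass ε .A14 A₀ A₁ := by
  have c11 := h.const_apply 1 1
  have l01 := h.linear_apply 0 1
  have l11 := h.linear_apply 1 1
  simp only [skewForm, h00, h01, h02, h03, h10, h12, h13, (h.left 0).1, (h.left 0).2, (h.left 1).1,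
    (h.left 1).2, map_one, map_zero, mul_one, mul_zero, zero_mul, one_mul, sub_zero, zero_sub,
    add_zero, zero_add, sub_self, neg_eq_zero] at c11 l01 l11
  have e1 := eq_ofReal_of_sub_conj (z := A₀ 1 1) (by linear_combination -c11)
  have f1 := eq_I_mul_of_add_conj (z := A₁ 1 1) (by linear_combination -l11)
  refine ⟨(A₀ 1 1).re, (A₁ 1 1).im, A₁ 0 0, A₁ 1 0, ?_, ?_⟩
  · rw [← e1]
    nth_rewrite 1 [eta_two_four A₀]
    rw [h00, h01, h02, h03, h10, h12, h13]
  · rw [← f1]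
    nth_rewrite 1 [eta_two_four A₁]
    rw [(h.left 0).1, (h.left 0).2, (h.left 1).1, (h.left 1).2, l01]

theorem IsotropicPair.inClass_A23 (h : IsotropicPair ε A₀ A₁) (h00 : A₀ 0 0 = 0) (h01 : A₀ 0 1 = 1)
    (h02 : A₀ 0 2 = 0) (h03 : A₀ 0 3 = 0) (h11 : A₀ 1 1 = 0) (h12 : A₀ 1 2 = 1)
    (h13 : A₀ 1 3 = 0) : InClass ε .A23 A₀ A₁ := by
  have c11 := h.const_apply 1 1
  have l01 := h.linear_apply 0 1
  have l11 := h.linear_apply 1 1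
  simp only [skewForm, h00, h01, h02, h03, h11, h12, h13, (h.left 0).1, (h.left 0).2, (h.left 1).1,
    (h.left 1).2, map_one, map_zero, mul_one, mul_zero, zero_mul, one_mul, sub_zero, zero_sub,
    add_zero, sub_self] at c11 l01 l11
  have e1 := eq_ofReal_of_sub_conj (z := A₀ 1 0) (by linear_combination c11)
  have f1 := eq_I_mul_of_add_conj (z := A₁ 1 0) (by linear_combination l11)
  refine ⟨(A₀ 1 0).re, (A₁ 1 0).im, A₁ 0 1, A₁ 1 1, ?_, ?_⟩
  · rw [← e1]
    nth_rewrite 1 [eta_two_four A₀]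
    rw [h00, h01, h02, h03, h11, h12, h13]
  · rw [← f1]
    nth_rewrite 1 [eta_two_four A₁]
    rw [(h.left 0).1, (h.left 0).2, (h.left 1).1, (h.left 1).2, l01]

theorem IsotropicPair.inClass_A24 (h : IsotropicPair ε A₀ A₁) (h00 : A₀ 0 0 ≠ 0) (h01 : A₀ 0 1 = 1)
    (h02 : A₀ 0 2 = 0) (h03 : A₀ 0 3 = 0) (h11 : A₀ 1 1 = 0) (h13 : A₀ 1 3 = 1) :
    InClass ε .A24 A₀ A₁ := by
  have c01 := h.const_apply 0 1
  have c11 := h.const_apply 1 1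
  have l01 := h.linear_apply 0 1
  have l11 := h.linear_apply 1 1
  simp only [skewForm, h01, h02, h03, h11, h13, (h.left 0).1, (h.left 0).2, (h.left 1).1,
    (h.left 1).2, map_one, map_zero, mul_one, mul_zero, zero_mul, one_mul, sub_zero, zero_sub,
    add_zero, sub_self] at c01 c11 l01 l11
  have h00' : conj (A₀ 0 0) ≠ 0 := by simpa using h00
  -- The off-diagonal equation for A₀ fixes this entry; the diagonal equations then concern
  -- combinations with the second row divided by A₀ 0 0.
  have h12' : conj (A₀ 1 2) = (A₀ 0 0)⁻¹ :=
    eq_inv_of_mul_eq_one_right (by linear_combination c01)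
  have h12 : A₀ 1 2 = (conj (A₀ 0 0))⁻¹ := by
    rw [← Complex.conj_conj (A₀ 1 2), h12', map_inv₀]
  rw [h12', h12] at c11 l11
  rw [h12'] at l01
  have e1 := eq_ofReal_of_sub_conj (z := (A₀ 1 0 - (ε : ℂ)⁻¹) * (A₀ 0 0)⁻¹) (by
    simp only [map_mul, map_sub, map_inv₀, Complex.conj_ofReal]
    linear_combination c11)
  have f1 := eq_I_mul_of_add_conj (z := A₁ 1 1 - A₁ 1 0 * (A₀ 0 0)⁻¹) (by
    simp only [map_mul, map_sub, map_inv₀]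
    linear_combination -l11)
  refine ⟨((A₀ 1 0 - (ε : ℂ)⁻¹) * (A₀ 0 0)⁻¹).re, (A₁ 1 1 - A₁ 1 0 * (A₀ 0 0)⁻¹).im, A₀ 0 0, A₀ 1 0,
    A₁ 0 0, A₁ 1 0, A₁ 1 1, h00, ?_, f1, ?_, ?_⟩
  · rw [← e1, mul_assoc, inv_mul_cancel₀ h00]
    ring
  · nth_rewrite 1 [eta_two_four A₀]
    rw [h01, h02, h03, h11, h12, h13]
  · nth_rewrite 1 [eta_two_four A₁]
    rw [(h.left 0).1, (h.left 0).2, (h.left 1).1, (h.left 1).2]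
    have : A₁ 0 1 = A₁ 0 0 * (A₀ 0 0)⁻¹ := by linear_combination -l01
    rw [this]

theorem row_ne_zero (hr : A₀.rank = 2) (i : Fin 2) : ∃ j, A₀ i j ≠ 0 := by
  by_contra! h
  have h2 := (rank_eq_two_iff A₀).1 hr (Pi.single i 1) (by
    rw [Matrix.single_one_vecMul]
    exact funext h)
  simpa using congrFun h2 i

/-- A matrix of full rank supported in the first two columns is equivalent to `[1 | 0]`. -/
theorem LeftSupported.exists_gl_mul {A : Matrix (Fin 2) (Fin 4) ℂ} (h : LeftSupported A)
    (hr : A.rank = 2) : ∃ G : GL (Fin 2) ℂ,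
      (G : Matrix (Fin 2) (Fin 2) ℂ) * A = !![1, 0, 0, 0; 0, 1, 0, 0] := by
  have hdet : (!![A 0 0, A 0 1; A 1 0, A 1 1]).det ≠ 0 := by
    intro h0
    obtain ⟨x, hx, hx0⟩ := Matrix.exists_vecMul_eq_zero_iff.2 h0
    refine hx ((rank_eq_two_iff A).1 hr x ?_)
    have e0 := congrFun hx0 0
    have e1 := congrFun hx0 1
    simp only [Matrix.vecMul, dotProduct, Fin.sum_univ_two, Matrix.of_apply, Matrix.cons_val_zero,
      Matrix.cons_val_one, Pi.zero_apply] at e0 e1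
    funext j
    simp only [Matrix.vecMul, dotProduct, Fin.sum_univ_two, Pi.zero_apply]
    fin_cases j
    · exact e0
    · exact e1
    · simp [(h 0).1, (h 1).1]
    · simp [(h 0).2, (h 1).2]
  rw [Matrix.det_fin_two_of] at hdet
  set D := A 0 0 * A 1 1 - A 0 1 * A 1 0 with hD
  -- The factor is the inverse of the left 2 × 2 block, by Cramer's rule.
  have hg : (D⁻¹ * A 1 1) * (D⁻¹ * A 0 0) - (-(D⁻¹ * A 0 1)) * (-(D⁻¹ * A 1 0)) ≠ 0 := by
    have : (D⁻¹ * A 1 1) * (D⁻¹ * A 0 0) - (-(D⁻¹ * A 0 1)) * (-(D⁻¹ * A 1 0)) = D⁻¹ * (D⁻¹ * D) := by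
      rw [hD]; ring
    rw [this, inv_mul_cancel₀ hdet, mul_one]
    exact inv_ne_zero hdet
  have hDi : D⁻¹ * D = 1 := inv_mul_cancel₀ hdet
  refine ⟨glOf _ _ _ _ hg, ?_⟩
  ext i j
  fin_cases i <;> fin_cases j <;>
    simp only [Fin.zero_eta, Fin.mk_one, Fin.reduceFinMk, glOf_mul_zero, glOf_mul_one, (h 0).1,
      (h 0).2, (h 1).1, (h 1).2, mul_zero, add_zero, Matrix.of_apply, Matrix.cons_val]
  · linear_combination hDi
  · ring
  · ring
  · linear_combination hDi

/-- Isotropy between the rows reads a₀₀ conj(a₁₂) = a₀₁ conj(a₁₃). So which of a₁₂, a₁₃ vanish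
determines which of a₀₀, a₀₁ do, and the four possibilities are the classes 𝔄₁₂, 𝔄₁₄, 𝔄₂₃, 𝔄₂₄.
Except in the first, a lower triangular factor scales the two pivots to 1 and clears the entry below
the upper one. -/
theorem IsotropicPair.hasNormalForm_of_row (h : IsotropicPair ε A₀ A₁) (hr : A₀.rank = 2)
    (h02 : A₀ 0 2 = 0) (h03 : A₀ 0 3 = 0) : HasNormalForm ε A₀ A₁ := by
  have c01 := h.const_apply 0 1
  simp only [skewForm, h02, h03, zero_mul, sub_zero, add_zero, sub_self, mul_zero] at c01
  have hrow : A₀ 0 0 ≠ 0 ∨ A₀ 0 1 ≠ 0 := by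
    by_contra! hn
    obtain ⟨j, hj⟩ := row_ne_zero hr 0
    fin_cases j
    · exact hj hn.1
    · exact hj hn.2
    · exact hj h02
    · exact hj h03
  by_cases h2 : A₀ 1 2 = 0 <;> by_cases h3 : A₀ 1 3 = 0
  · have hl : LeftSupported A₀ := by
      intro i
      fin_cases i
      · exact ⟨h02, h03⟩
      · exact ⟨h2, h3⟩
    obtain ⟨G, hG⟩ := hl.exists_gl_mul hr
    refine ⟨.A12, by simp, by simp, G, ?_⟩
    have hl1 := h.left.mul (G : Matrix (Fin 2) (Fin 2) ℂ)
    set A' := (G : Matrix (Fin 2) (Fin 2) ℂ) * A₁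
    refine ⟨A' 0 0, A' 0 1, A' 1 0, A' 1 1, hG, ?_⟩
    nth_rewrite 1 [eta_two_four A']
    rw [(hl1 0).1, (hl1 0).2, (hl1 1).1, (hl1 1).2]
  · have c3 : conj (A₀ 1 3) ≠ 0 := by simpa using h3
    rw [h2, map_zero, mul_zero, zero_sub, neg_eq_zero] at c01
    have h01 : A₀ 0 1 = 0 := (mul_eq_zero.1 c01).resolve_right c3
    have h00 : A₀ 0 0 ≠ 0 := hrow.resolve_right (not_not.2 h01)
    have hg : (A₀ 0 0)⁻¹ * (A₀ 1 3)⁻¹ - 0 * (-(A₀ 1 0 * (A₀ 0 0)⁻¹ * (A₀ 1 3)⁻¹)) ≠ 0 := by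
      rw [zero_mul, sub_zero]
      exact mul_ne_zero (inv_ne_zero h00) (inv_ne_zero h3)
    refine HasNormalForm.of_gl_mul (glOf _ _ _ _ hg) (.of_inClass (c := .A14) (by simp) (by simp)
      ((h.mul _).inClass_A14 ?_ ?_ ?_ ?_ ?_ ?_ ?_)) <;>
      simp only [glOf_mul_zero, glOf_mul_one, h01, h02, h03, h2] <;> field_simp <;> ring
  · have c2 : conj (A₀ 1 2) ≠ 0 := by simpa using h2
    rw [h3, map_zero, mul_zero, sub_zero] at c01
    have h00 : A₀ 0 0 = 0 := (mul_eq_zero.1 c01).resolve_right c2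
    have h01 : A₀ 0 1 ≠ 0 := hrow.resolve_left (not_not.2 h00)
    have hg : (A₀ 0 1)⁻¹ * (A₀ 1 2)⁻¹ - 0 * (-(A₀ 1 1 * (A₀ 0 1)⁻¹ * (A₀ 1 2)⁻¹)) ≠ 0 := by
      rw [zero_mul, sub_zero]
      exact mul_ne_zero (inv_ne_zero h01) (inv_ne_zero h2)
    refine HasNormalForm.of_gl_mul (glOf _ _ _ _ hg) (.of_inClass (c := .A23) (by simp) (by simp)
      ((h.mul _).inClass_A23 ?_ ?_ ?_ ?_ ?_ ?_ ?_)) <;>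
      simp only [glOf_mul_zero, glOf_mul_one, h00, h02, h03, h3] <;> field_simp <;> ring
  · have c2 : conj (A₀ 1 2) ≠ 0 := by simpa using h2
    have c3 : conj (A₀ 1 3) ≠ 0 := by simpa using h3
    have h01 : A₀ 0 1 ≠ 0 := by
      intro h01
      rw [h01, zero_mul, sub_zero] at c01
      exact hrow.elim (fun h => h ((mul_eq_zero.1 c01).resolve_right c2)) fun h => h h01
    have h00 : A₀ 0 0 ≠ 0 := by
      intro h00
      rw [h00, zero_mul, zero_sub, neg_eq_zero] at c01
      exact h01 ((mul_eq_zero.1 c01).resolve_right c3)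
    have hg : (A₀ 0 1)⁻¹ * (A₀ 1 3)⁻¹ - 0 * (-(A₀ 1 1 * (A₀ 0 1)⁻¹ * (A₀ 1 3)⁻¹)) ≠ 0 := by
      rw [zero_mul, sub_zero]
      exact mul_ne_zero (inv_ne_zero h01) (inv_ne_zero h3)
    refine HasNormalForm.of_gl_mul (glOf _ _ _ _ hg) (.of_inClass (c := .A24) (by simp) (by simp)
      ((h.mul _).inClass_A24 ?_ ?_ ?_ ?_ ?_ ?_)) <;>
      simp only [glOf_mul_zero, glOf_mul_one, h02, h03, zero_mul, add_zero]
    · exact mul_ne_zero (inv_ne_zero h01) h00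
    all_goals field_simp <;> ring

/-- An isotropic pair with `A₀` of full rank is brought into one of the first five classes by
a constant factor. -/
theorem IsotropicPair.hasNormalForm (h : IsotropicPair ε A₀ A₁) (hr : A₀.rank = 2) :
    HasNormalForm ε A₀ A₁ := by
  -- If the right block of A₀ is singular, a left null vector of it, taken as first row of the
  -- factor, clears the last two entries of the first row. Otherwise its inverse normalises it to
  -- the identity, which is the shape of 𝔄₃₄.
  by_cases hdet : A₀ 0 2 * A₀ 1 3 - A₀ 0 3 * A₀ 1 2 = 0
  · obtain ⟨x, hx, hx0⟩ := Matrix.exists_vecMul_eq_zero_iff.2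
      (show (!![A₀ 0 2, A₀ 0 3; A₀ 1 2, A₀ 1 3]).det = 0 by rwa [Matrix.det_fin_two_of])
    have e0 := congrFun hx0 0
    have e1 := congrFun hx0 1
    simp only [Matrix.vecMul, dotProduct, Fin.sum_univ_two, Matrix.of_apply, Matrix.cons_val_zero,
      Matrix.cons_val_one, Pi.zero_apply] at e0 e1
    obtain ⟨g, hg⟩ := exists_gl_mul_zero_apply hx
    refine HasNormalForm.of_gl_mul g ((h.mul _).hasNormalForm_of_row ?_ ?_ ?_)
    · rw [rank_gl_mul, hr]
    · rw [hg]
      simpa only [Matrix.vecMul, dotProduct, Fin.sum_univ_two] using e0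
    · rw [hg]
      simpa only [Matrix.vecMul, dotProduct, Fin.sum_univ_two] using e1
  · set D := A₀ 0 2 * A₀ 1 3 - A₀ 0 3 * A₀ 1 2 with hD
    have hDi : D⁻¹ * D = 1 := inv_mul_cancel₀ hdet
    have hg : (D⁻¹ * A₀ 1 3) * (D⁻¹ * A₀ 0 2) - (-(D⁻¹ * A₀ 0 3)) * (-(D⁻¹ * A₀ 1 2)) ≠ 0 := by
      have : (D⁻¹ * A₀ 1 3) * (D⁻¹ * A₀ 0 2) - (-(D⁻¹ * A₀ 0 3)) * (-(D⁻¹ * A₀ 1 2))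
          = D⁻¹ * (D⁻¹ * D) := by
        rw [hD]; ring
      rw [this, hDi, mul_one]
      exact inv_ne_zero hdet
    refine HasNormalForm.of_gl_mul (glOf _ _ _ _ hg) (.of_inClass (c := .A34) (by simp) (by simp)
      ((h.mul _).inClass_A34 ?_ ?_ ?_ ?_)) <;>
      simp only [glOf_mul_zero, glOf_mul_one]
    · linear_combination hDi
    · ring
    · ring
    · linear_combination hDi

end NormalForm

/-! ### Pencils whose constant term may be singular -/

/-- An isotropic pencil of full rank for almost every `k` is equivalent, for almost every `k`,
to one and the same member of the table. -/
theorem exists_inClass_of_ae {ε : ℝ} {A₀ A₁ : Matrix (Fin 2) (Fin 4) ℂ} (hl : LeftSupported A₁)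
    (h : ∀ᵐ k : ℝ, (pencil A₀ A₁ k).rank = 2 ∧
      pencil A₀ A₁ k * dualMatrix ε * (pencil A₀ A₁ k)ᴴ = 0) :
    ∃ c A₀' A₁', InClass ε c A₀' A₁' ∧ ∀ᵐ k : ℝ, Equivalent (pencil A₀ A₁ k) (pencil A₀' A₁' k) := by
  by_cases hr : A₀.rank = 2
  · obtain ⟨c, -, -, G, hG⟩ :=
      (IsotropicPair.of_ae hl (h.mono fun k hk => hk.2)).hasNormalForm hr
    exact ⟨c, _, _, hG, .of_forall fun k => ⟨G, mul_pencil _ _ _ _⟩⟩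
  rw [rank_eq_two_iff] at hr
  push Not at hr
  obtain ⟨x, hx0, hx⟩ := hr
  obtain ⟨g, hg⟩ := exists_gl_mul_zero_apply hx
  set C₀ := (g : Matrix (Fin 2) (Fin 2) ℂ) * A₀
  set C₁ := (g : Matrix (Fin 2) (Fin 2) ℂ) * A₁
  have hC₀ : ∀ j, C₀ 0 j = 0 := fun j =>
    (hg A₀ j).trans (congrFun hx0 j)
  have hC₁ : LeftSupported C₁ := hl.mul _
  -- The first row of C₀ is zero, so the first row of the pencil is ik times that of C₁. Dividing it
  -- by ik for k ≠ 0 makes it part of the constant term.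
  let D₀ : Matrix (Fin 2) (Fin 4) ℂ := Matrix.of ![C₁ 0, C₀ 1]
  let D₁ : Matrix (Fin 2) (Fin 4) ℂ := Matrix.of ![0, C₁ 1]
  have hD₁ : LeftSupported D₁ := by
    intro i
    fin_cases i
    · simp [D₁]
    · exact hC₁ 1
  have hequiv : ∀ᵐ k : ℝ, Equivalent (pencil A₀ A₁ k) (pencil D₀ D₁ k) := by
    filter_upwards [(Set.finite_singleton (0 : ℝ)).countable.ae_notMem volume] with k hk
    have hk0 : Complex.I * (k : ℂ) ≠ 0 :=
      mul_ne_zero Complex.I_ne_zero (Complex.ofReal_ne_zero.2 hk)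
    refine Equivalent.trans ⟨g, rfl⟩ (Equivalent.symm ⟨glOf (Complex.I * k) 0 0 1 (by simpa using hk0), ?_⟩)
    rw [← mul_pencil]
    change pencil C₀ C₁ k = _
    ext i j
    fin_cases i
    · simp only [Fin.zero_eta, glOf_mul_zero]
      simp [pencil, D₀, D₁, hC₀]
    · simp only [Fin.mk_one, glOf_mul_one]
      simp [pencil, D₀, D₁]
  have hD : ∀ᵐ k : ℝ, (pencil D₀ D₁ k).rank = 2 ∧
      pencil D₀ D₁ k * dualMatrix ε * (pencil D₀ D₁ k)ᴴ = 0 := by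
    filter_upwards [h, hequiv] with k hk he
    exact ⟨he.rank_eq.trans hk.1, he.isotropic hk.2⟩
  by_cases hv : C₀ 1 2 = 0 ∧ C₀ 1 3 = 0
  · refine ⟨.A12, !![1, 0, 0, 0; 0, 1, 0, 0], 0, ⟨0, 0, 0, 0, rfl, ?_⟩, ?_⟩
    · ext i j
      fin_cases i <;> fin_cases j <;> rfl
    · filter_upwards [hD, hequiv] with k hk he
      have hls : LeftSupported (pencil D₀ D₁ k) := by
        intro i
        fin_cases i
        · simp [pencil, D₀, D₁, (hC₁ 0).1, (hC₁ 0).2]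
        · simp [pencil, D₀, D₁, hv.1, hv.2, (hC₁ 1).1, (hC₁ 1).2]
      obtain ⟨G, hG⟩ := hls.exists_gl_mul hk.1
      refine he.trans ⟨G, ?_⟩
      rw [hG, pencil, smul_zero, add_zero]
  · have hrD : D₀.rank = 2 := by
      obtain ⟨k, hk, -⟩ := hD.exists
      obtain ⟨j, hj⟩ := row_ne_zero hk 0
      have hj' : C₁ 0 j ≠ 0 := by simpa [pencil, D₀, D₁] using hj
      rw [rank_eq_two_iff]
      intro y hy
      have hy' : ∀ j, y 0 * C₁ 0 j + y 1 * C₀ 1 j = 0 := by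
        intro j
        have := congrFun hy j
        simpa [Matrix.vecMul, dotProduct, Fin.sum_univ_two, D₀] using this
      have y1 : y 1 = 0 := by
        by_contra hy1
        refine hv ⟨?_, ?_⟩
        · simpa [(hC₁ 0).1, hy1] using hy' 2
        · simpa [(hC₁ 0).2, hy1] using hy' 3
      have y0 : y 0 = 0 := by simpa [y1, hj'] using hy' j
      funext i
      fin_cases i
      · exact y0
      · exact y1
    obtain ⟨c, -, -, G, hG⟩ :=
      (IsotropicPair.of_ae hD₁ (hD.mono fun k hk => hk.2)).hasNormalForm hrD
    refine ⟨c, _, _, hG, ?_⟩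
    filter_upwards [hequiv] with k he
    exact he.trans ⟨G, mul_pencil _ _ _ _⟩

theorem leftSupported_blocks_zero (B : Matrix (Fin 2) (Fin 2) ℂ) : LeftSupported (blocks B 0) := by
  intro i
  fin_cases i <;> simp [blocks]

end EdgeDirac

/-! ### The three statements -/

theorem theorem1 (m ε : ℝ) (hm : 0 < m) (hε : 0 < ε) (hεm : ε < 1 / (2 * m))
    (B₀ B₁ B₂ : Matrix (Fin 2) (Fin 2) ℂ)
    (A₀ A₁ : Matrix (Fin 2) (Fin 4) ℂ)
    (hA₀ : A₀ = EdgeDirac.blocks B₀ B₂) (hA₁ : A₁ = EdgeDirac.blocks B₁ 0)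
    (A : ℝ → Matrix (Fin 2) (Fin 4) ℂ) (hA : A = EdgeDirac.pencil A₀ A₁) :
    -- one and the same member of the table for almost every `k`
    ((∀ᵐ k : ℝ, IsSelfAdjoint (EdgeDirac.edgeHamiltonian m ε k (A k))) ↔
      ∃ c A₀' A₁', EdgeDirac.InClass ε c A₀' A₁' ∧
        ∀ᵐ k : ℝ, (A k).rank = 2 ∧ EdgeDirac.Equivalent (A k) (EdgeDirac.pencil A₀' A₁' k)) ∧
    -- the equivalence at each fixed `k`
    (∀ k : ℝ, IsSelfAdjoint (EdgeDirac.edgeHamiltonian m ε k (A k)) ↔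
      (A k).rank = 2 ∧ ∃ c A₀' A₁', EdgeDirac.InClass ε c A₀' A₁' ∧
        EdgeDirac.Equivalent (A k) (EdgeDirac.pencil A₀' A₁' k)) ∧
    -- for `A₀` of rank 2, one `GL₂` factor serves all `k`, and only the first five classes occur
    (A₀.rank = 2 →
      ((∀ᵐ k : ℝ, IsSelfAdjoint (EdgeDirac.edgeHamiltonian m ε k (A k))) ↔
        ∃ c A₀' A₁', c ≠ EdgeDirac.BCClass.B ∧ c ≠ EdgeDirac.BCClass.C ∧
          EdgeDirac.InClass ε c A₀' A₁' ∧
          ∃ G : GL (Fin 2) ℂ, A₀' = (G : Matrix (Fin 2) (Fin 2) ℂ) * A₀ ∧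
            A₁' = (G : Matrix (Fin 2) (Fin 2) ℂ) * A₁)) := by
  have hl : EdgeDirac.LeftSupported A₁ := hA₁ ▸ EdgeDirac.leftSupported_blocks_zero B₁
  subst hA
  simp only [EdgeDirac.isSelfAdjoint_iff_rank hε.ne']
  refine ⟨⟨fun h => ?_, ?_⟩, fun k => ⟨fun h => ⟨h.1, ?_⟩, ?_⟩, fun hr => ⟨fun h => ?_, ?_⟩⟩
  · obtain ⟨c, A₀', A₁', hc, he⟩ := EdgeDirac.exists_inClass_of_ae hl h
    exact ⟨c, A₀', A₁', hc, (h.and he).mono fun k hk => ⟨hk.1.1, hk.2⟩⟩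
  · rintro ⟨c, A₀', A₁', hc, h⟩
    exact h.mono fun k hk => ⟨hk.1, hk.2.symm.isotropic ((hc.isotropicPair hε.ne').isotropic k)⟩
  · have hpair : EdgeDirac.IsotropicPair ε (EdgeDirac.pencil A₀ A₁ k) 0 :=
      ⟨fun i => by simp, h.2, by simp⟩
    obtain ⟨c, -, -, G, hG⟩ := hpair.hasNormalForm h.1
    refine ⟨c, _, _, hG, G, ?_⟩
    rw [EdgeDirac.mul_pencil, EdgeDirac.pencil, smul_zero, add_zero]
  · rintro ⟨hr, c, A₀', A₁', hc, he⟩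
    exact ⟨hr, he.symm.isotropic ((hc.isotropicPair hε.ne').isotropic k)⟩
  · obtain ⟨c, h1, h2, G, hG⟩ :=
      (EdgeDirac.IsotropicPair.of_ae hl (h.mono fun k hk => hk.2)).hasNormalForm hr
    exact ⟨c, _, _, h1, h2, hG, G, rfl, rfl⟩
  · rintro ⟨c, A₀', A₁', -, -, hc, G, rfl, rfl⟩
    -- Isotropy holds for every k, but the rank of A(k) may drop at finitely many k.
    filter_upwards [EdgeDirac.ae_rank_pencil A₁ hr] with k hk
    refine ⟨hk, EdgeDirac.Equivalent.isotropic (EdgeDirac.Equivalent.symm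
      ⟨G, EdgeDirac.mul_pencil _ _ _ _⟩) ((hc.isotropicPair hε.ne').isotropic k)⟩
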